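/- Let $L$ be a finite set, $\mathcal M$ a collection of subsets of $L$ (the contexts), $d\ge 2$ an integer, $\tau:\mathcal M\to\mathbb Z_d$ a function, and let a sign $\epsilon_C(a)\in\{\pm1\}$ be given for every $C\in\mathcal M$ and $a\in C$ (for instance $\epsilon_C(a)=\epsilon(a)$ for a function $\epsilon:L\to\{\pm1\}$). A classical realization of the constraints is a function $c:L\to\mathbb Z_d$ with $\prod_{a\in C}\omega^{\epsilon_C(a)c(a)}=\omega^{\tau(C)}$ for all $C\in\mathcal M$, where $\omega=e^{2\pi i/d}$. The solution group $G$ is the group generated by $g_a$ ($a\in L$) and $J$ with the relations $J^d=g_a^d=1$ and $[J,g_a]=1$ for all $a\in L$, $[g_a,g_b]=1$ whenever $a,b\in C\in\mathcal M$, and $\prod_{a\in C}g_a^{\epsilon_C(a)}=J^{\tau(C)}$ for all $C\in\mathcal M$. Put $\bar G=G/\langle J\rangle$. Let $X$ be a topological realization of the arrangement: a connected $2$-dimensional cell complex with $1$-cells labelled by $L$ and $2$-cells labelled by $\mathcal M$, such that the boundary of the $2$-cell $C$ is glued along a closed edge path that traverses each $a\in C$ exactly once, in some order, in the direction given by $\epsilon_C(a)$,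 and no other edge. Let $v$ be a vertex of $X$, and for a closed edge path $p=a_1^{\epsilon_1}\cdots a_k^{\epsilon_k}$ at $v$ put $g_p=g_{a_1}^{\epsilon_1}\cdots g_{a_k}^{\epsilon_k}$. Then there is a unique homomorphism $\theta:\pi_1(X,v)\to\bar G$ that sends $[p]$ to the class of $g_p$ for every closed edge path $p$ at $v$. If a classical realization exists, then $\theta$ lifts to a homomorphism $\tilde\theta:\pi_1(X,v)\to G$. If $J$ has order exactly $d$ in $G$, then $\theta$ lifts to a homomorphism $\tilde\theta:\pi_1(X,v)\to G$ if and only if a classical realization exists. -/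

import Mathlib

/-! ### Signed arrangements and classical realizations -/

/-- A signed arrangement on the label set `L`: a collection of subsets of `L` (the contexts),
and a sign for each label of each context. A sign function `ε : L → {±1}` that does not depend
on the context is the special case `sign C a = ε a`. -/
structure SignedArrangement (L : Type*) where
  contexts : Set (Finset L)
  sign : contexts → L → ℤˣ

namespace SignedArrangement

variable {L : Type*} (A : SignedArrangement L)

/-- A classical realization of the constraints given by `τ`: a function `c : L → ℤ/d` with
`∏_{a ∈ C} ω ^ (ε a * c a) = ω ^ τ C` for every context `C`, where `ω = exp (2πi/d)`. -/
def IsClassicalRealization {d : ℕ} (τ : A.contexts → ZMod d) (c : L → ZMod d) : Prop :=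
  ∀ C : A.contexts,
    ∏ a ∈ C.1, Complex.exp (2 * Real.pi * Complex.I / d) ^ ((A.sign C a : ℤ) * ((c a).val : ℤ)) =
      Complex.exp (2 * Real.pi * Complex.I / d) ^ (τ C).val

/-! ### The solution group -/

open scoped commutatorElement

/-- The generators `g a`, `a ∈ L`, and `J` of the solution group. -/
inductive SolutionGen (L : Type*) where
  | g (a : L) : SolutionGen L
  | J : SolutionGen L

/-- The generator `g a` in the free group. -/
def freeG {L : Type*} (a : L) : FreeGroup (SolutionGen L) := FreeGroup.of (SolutionGen.g a)

/-- The generator `J` in the free group. -/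
def freeJ (L : Type*) : FreeGroup (SolutionGen L) := FreeGroup.of SolutionGen.J

/-- The relators of the solution group. In the last one, `l` runs over all enumerations of the
context `C` without repetition; by the commutation relations they all express the same relation
`∏_{a ∈ C} g a ^ ε a = J ^ τ C`. -/
inductive SolutionRel {d : ℕ} (τ : A.contexts → ZMod d) : FreeGroup (SolutionGen L) → Prop
  | J_pow : SolutionRel τ (freeJ L ^ d)
  | g_pow (a : L) : SolutionRel τ (freeG a ^ d)
  | J_comm (a : L) : SolutionRel τ ⁅freeJ L, freeG a⁆
  | g_comm (C : A.contexts) (a b : L) (ha : a ∈ C.1) (hb : b ∈ C.1) :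
      SolutionRel τ ⁅freeG a, freeG b⁆
  | context (C : A.contexts) (l : List L) (hl : (l : Multiset L) = C.1.val) :
      SolutionRel τ
        ((l.map fun a => freeG a ^ (A.sign C a : ℤ)).prod *
          (freeJ L ^ (τ C).val)⁻¹)

/-- The solution group `G`. -/
abbrev SolutionGroup {d : ℕ} (τ : A.contexts → ZMod d) : Type _ :=
  PresentedGroup {r | A.SolutionRel τ r}

variable {d : ℕ} (τ : A.contexts → ZMod d)

/-- The generator `g a` of the solution group. -/
def solG (a : L) : A.SolutionGroup τ := PresentedGroup.of (SolutionGen.g a)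

/-- The central generator `J` of the solution group. -/
def solJ : A.SolutionGroup τ := PresentedGroup.of SolutionGen.J

theorem solJ_commute (x : A.SolutionGroup τ) : A.solJ τ * x = x * A.solJ τ := by
  have hx : x ∈ Subgroup.centralizer {A.solJ τ} := by
    have htop : Subgroup.closure (Set.range (PresentedGroup.of (rels := {r | A.SolutionRel τ r})))
        ≤ Subgroup.centralizer {A.solJ τ} := by
      rw [Subgroup.closure_le]
      rintro _ ⟨y, rfl⟩
      rw [SetLike.mem_coe, Subgroup.mem_centralizer_singleton_iff]
      cases y with
      | J => rfl
      | g a =>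
        have h : (PresentedGroup.mk {r | A.SolutionRel τ r})
            ⁅freeJ L, freeG a⁆ = 1 :=
          PresentedGroup.one_of_mem (SolutionRel.J_comm a)
        rw [map_commutatorElement, commutatorElement_eq_one_iff_mul_comm] at h
        exact h.symm
    rw [PresentedGroup.closure_range_of] at htop
    exact htop (Subgroup.mem_top x)
  exact (Subgroup.mem_centralizer_singleton_iff.mp hx).symm

instance zpowers_solJ_normal : (Subgroup.zpowers (A.solJ τ)).Normal where
  conj_mem n hn x := by
    obtain ⟨k, rfl⟩ := hn
    have h : Commute x (A.solJ τ ^ k) := (show Commute x (A.solJ τ) from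
      (A.solJ_commute τ x).symm).zpow_right k
    show x * A.solJ τ ^ k * x⁻¹ ∈ _
    rw [h.eq, mul_inv_cancel_right]
    exact ⟨k, rfl⟩

/-- The quotient `Ḡ = G / ⟨J⟩`. -/
abbrev SolutionQuotient : Type _ := A.SolutionGroup τ ⧸ Subgroup.zpowers (A.solJ τ)

/-- The projection `G → Ḡ`. -/
abbrev solProj : A.SolutionGroup τ →* A.SolutionQuotient τ :=
  QuotientGroup.mk' (Subgroup.zpowers (A.solJ τ))

end SignedArrangement

/-! ### Combinatorial 2-complexes -/

universe u v w

/-- Edge paths in the oriented graph with vertices `V` and edges `E`, by their first step: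
`fwd e p` traverses `e` from source to target and then `p`, while `bwd e p` traverses `e`
backwards and then `p`. -/
inductive EdgePath {V E : Type*} (src tgt : E → V) : V → V → Type _
  | nil (v : V) : EdgePath src tgt v v
  | fwd (e : E) {w : V} (p : EdgePath src tgt (tgt e) w) : EdgePath src tgt (src e) w
  | bwd (e : E) {w : V} (p : EdgePath src tgt (src e) w) : EdgePath src tgt (tgt e) w

namespace EdgePath

variable {V E : Type*} {src tgt : E → V}

/-- The signed edges traversed by an edge path, in order. -/
def word : {v w : V} → EdgePath src tgt v w → List (E × ℤˣ)
  | _, _, nil _ => []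
  | _, _, fwd e p => (e, 1) :: p.word
  | _, _, bwd e p => (e, -1) :: p.word

/-- The product of `g e ^ (±1)` over the signed edges of an edge path, in order. -/
def eval {G : Type*} [Group G] (g : E → G) {v w : V} (p : EdgePath src tgt v w) : G :=
  (p.word.map fun x => g x.1 ^ (x.2 : ℤ)).prod

end EdgePath

/-- The combinatorial data of a 2-dimensional complex with set of 1-cells `E` and set of 2-cells
`F`: a set of vertices, the end points of the edges, and for each 2-cell the closed edge path
(possibly trivial) along which the boundary of the 2-cell is glued. -/
structure TwoComplex (E : Type u) (F : Type v) where
  V : Type w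
  src : E → V
  tgt : E → V
  base : F → V
  bdry : ∀ f : F, EdgePath src tgt (base f) (base f)

namespace TwoComplex

variable {E : Type u} {F : Type v} (X : TwoComplex.{u, v, w} E F)

/-- Gluing the end points of the edges, copies of `[0,1]`, to the discrete set of vertices. -/
inductive EdgeGlue :
    ((Σ _ : X.V, Unit) ⊕ (Σ _ : E, unitInterval)) →
      ((Σ _ : X.V, Unit) ⊕ (Σ _ : E, unitInterval)) → Prop
  | src (e : E) : EdgeGlue (.inr ⟨e, 0⟩) (.inl ⟨X.src e, ()⟩)
  | tgt (e : E) : EdgeGlue (.inr ⟨e, 1⟩) (.inl ⟨X.tgt e, ()⟩)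

/-- The 1-skeleton as a topological space (with the quotient topology). -/
def Skeleton : Type _ := Quot X.EdgeGlue

instance : TopologicalSpace X.Skeleton := inferInstanceAs (TopologicalSpace (Quot X.EdgeGlue))

/-- The vertices as points of the 1-skeleton. -/
def skelVert (v : X.V) : X.Skeleton := Quot.mk _ (.inl ⟨v, ()⟩)

/-- The edge `e` as a path in the 1-skeleton. -/
def edge (e : E) : Path (X.skelVert (X.src e)) (X.skelVert (X.tgt e)) where
  toFun t := Quot.mk _ (.inr ⟨e, t⟩)
  continuous_toFun := continuous_quot_mk.comp (continuous_inr.comp continuous_sigmaMk)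
  source' := Quot.sound (.src e)
  target' := Quot.sound (.tgt e)

/-- The path `γ` followed by the edge path `p`. -/
noncomputable def extend {x : X.Skeleton} : {v w : X.V} → (p : EdgePath X.src X.tgt v w) →
    (γ : Path x (X.skelVert v)) → Path x (X.skelVert w)
  | _, _, .nil _, γ => γ
  | _, _, .fwd e p, γ => extend p (γ.trans (X.edge e))
  | _, _, .bwd e p, γ => extend p (γ.trans (X.edge e).symm)

/-- The path in the 1-skeleton that traverses the edges of an edge path in order. -/
noncomputable def skelPath : {v w : X.V} → EdgePath X.src X.tgt v w → Path (X.skelVert v) (X.skelVert w)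
  | _, _, .nil v => Path.refl (X.skelVert v)
  | _, _, .fwd e p => X.extend p (X.edge e)
  | _, _, .bwd e p => X.extend p (X.edge e).symm

/-- Gluing the 2-cells, copies of the closed unit disk, to the 1-skeleton: the boundary point
`exp (2πit)` of the disk `f` is glued to the point at time `t` of the boundary path of `f`. -/
inductive FaceGlue :
    (X.Skeleton ⊕ (Σ _ : F, Metric.closedBall (0 : ℂ) 1)) →
      (X.Skeleton ⊕ (Σ _ : F, Metric.closedBall (0 : ℂ) 1)) → Prop
  | bdry (f : F) (t : unitInterval) (z : Metric.closedBall (0 : ℂ) 1)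
      (hz : (z : ℂ) = Complex.exp (2 * Real.pi * (t : ℝ) * Complex.I)) :
      FaceGlue (.inr ⟨f, z⟩) (.inl (X.skelPath (X.bdry f) t))

/-- The complex as a topological space (with the quotient topology). -/
def Space : Type _ := Quot X.FaceGlue

instance : TopologicalSpace X.Space := inferInstanceAs (TopologicalSpace (Quot X.FaceGlue))

/-- The map from the 1-skeleton to the complex. -/
def ofSkeleton : C(X.Skeleton, X.Space) where
  toFun x := Quot.mk _ (.inl x)
  continuous_toFun := continuous_quot_mk.comp continuous_inl

/-- The vertices as points of the complex. -/
def vert (v : X.V) : X.Space := X.ofSkeleton (X.skelVert v)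

/-- The fundamental group `π₁(X, v)` in which `[p] * [q]` is the class of `p` followed by `q`.
(In Mathlib's `FundamentalGroup` the product is taken in the opposite order.) -/
abbrev Pi1 (v : X.V) : Type _ := (FundamentalGroup X.Space (X.vert v))ᵐᵒᵖ

/-- The class in `π₁(X, v)` of a closed edge path at `v`. -/
noncomputable def loopClass {v : X.V} (p : EdgePath X.src X.tgt v v) : X.Pi1 v :=
  MulOpposite.op (FundamentalGroup.fromPath
    (Path.Homotopic.Quotient.mk ((X.skelPath p).map X.ofSkeleton.continuous)))

end TwoComplex

/-- A topological realization of a signed arrangement: a connected complex whose 1-cells are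
labelled by `L` and whose 2-cells are labelled by the contexts, such that the boundary of the
2-cell `C` traverses every `a ∈ C` exactly once, in the direction given by its sign, and no other
edge. Every order of the elements of `C` is allowed. -/
structure TwoComplex.IsTopologicalRealization {L : Type u} (A : SignedArrangement L)
    (X : TwoComplex.{u, u, w} L A.contexts) : Prop where
  connected : ConnectedSpace X.Space
  bdry_word : ∀ C : A.contexts,
    ((X.bdry C).word : Multiset (L × ℤˣ)) = C.1.val.map fun a => (a, A.sign C a)

/-! A labelling of the 1-cells by a group `H` whose product around every 2-cell is trivial defines a
homomorphism from the fundamental group to `H` (`exists_pathFunctional`). The homomorphism is the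
holonomy of a flat `H`-bundle. On the 1-skeleton the bundle is given by a locally constant
transition across each edge. Over a 2-cell it extends radially, because trivial boundary holonomy
gives a flat section along the attaching circle. Lifting paths and homotopies in the associated
covering makes holonomy multiplicative and homotopy invariant. In the other direction, every loop at
a vertex is homotopic to an edge loop (`exists_edgePath_homotopic`), so a homomorphism is determined
by its values on edge loops.

The classes of the `g a` in the quotient by `J` satisfy the boundary condition, and this gives `θ`.
A classical realization `c` corrects the labels in `G` itself: the product of the `g a * J ^ (-c a)`
around `C` is `J` to the power `τ C - ∑ ε c`, which is trivial, so these labels define a lift.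

Conversely, a lift assigns elements of `G` to all paths once paths from the base point have been
chosen. A change of gauge at the vertices removes this choice modulo `J`, so each edge gets a label
`g a * J ^ m a`. The boundary of each 2-cell is null-homotopic, so `J` to the power `τ C + ∑ ε m` is
trivial. If `J` has order `d`, this says that `-m` is a classical realization
(`exists_isClassicalRealization`). -/

open scoped unitInterval

/-! ### Flat cocycles and their holonomy -/

/-- An atlas for a principal `H`-bundle with discrete structure group on `X`: an open cover, and
on each chart a comparison `sec i` with a global set-theoretic section, such that the transition
functions `(sec i)⁻¹ * sec j` are continuous for the discrete topology of `H`. -/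
structure FlatAtlas (ι X H : Type*) [TopologicalSpace X] [Group H] [TopologicalSpace H] where
  U : ι → Set X
  isOpen_U : ∀ i, IsOpen (U i)
  cover : ∀ x, ∃ i, x ∈ U i
  sec : ι → X → H
  compat : ∀ i j, ContinuousOn (fun x => (sec i x)⁻¹ * sec j x) (U i ∩ U j)

namespace FlatAtlas

variable {ι X H Y Z : Type*} [TopologicalSpace X] [TopologicalSpace Y] [TopologicalSpace Z]
  [Group H] [TopologicalSpace H] (𝒜 : FlatAtlas ι X H)

/-- A function `s` that represents a locally constant section along `f`. -/
def IsFlat (f : Y → X) (s : Y → H) : Prop :=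
  ∀ i, ContinuousOn (fun y => s y * 𝒜.sec i (f y)) (f ⁻¹' 𝒜.U i)

variable {𝒜}

theorem IsFlat.comp {f : Y → X} {s : Y → H} (h : 𝒜.IsFlat f s) {g : Z → Y} (hg : Continuous g) :
    𝒜.IsFlat (f ∘ g) (s ∘ g) := fun i =>
  (h i).comp hg.continuousOn fun _ hz => hz

theorem IsFlat.congr {f f' : Y → X} {s s' : Y → H} (h : 𝒜.IsFlat f s) (hf : ∀ y, f' y = f y)
    (hs : ∀ y, s' y = s y) : 𝒜.IsFlat f' s' := by
  rwa [funext hf, funext hs]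

variable [DiscreteTopology H]

/-- Charts act on sections from the right, so left translation commutes with them. -/
theorem IsFlat.mul_left {f : Y → X} {s : Y → H} (h : 𝒜.IsFlat f s) (a : H) :
    𝒜.IsFlat f (fun y => a * s y) := fun i => by
  have := (continuous_of_discreteTopology (f := fun x : H => a * x)).comp_continuousOn (h i)
  refine this.congr fun y _ => ?_
  simp [mul_assoc]

/-- In each chart the factor `sec i` cancels from the quotient of the two sections. The quotient is
therefore continuous into a discrete space, hence constant. -/
theorem IsFlat.eq_mul [PreconnectedSpace Y] {f : Y → X} (hf : Continuous f) {s s' : Y → H}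
    (h : 𝒜.IsFlat f s) (h' : 𝒜.IsFlat f s') (y z : Y) : s y * (s' y)⁻¹ = s z * (s' z)⁻¹ := by
  have hc : Continuous fun y => s y * (s' y)⁻¹ := by
    rw [continuous_iff_continuousAt]
    intro y
    obtain ⟨i, hi⟩ := 𝒜.cover (f y)
    have hn : f ⁻¹' 𝒜.U i ∈ nhds y := ((𝒜.isOpen_U i).preimage hf).mem_nhds hi
    have h2 := ((h i).continuousAt hn).prodMk ((h' i).continuousAt hn)
    have h3 := (continuous_of_discreteTopology
      (f := fun p : H × H => p.1 * p.2⁻¹)).continuousAt.comp h2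
    refine h3.congr (Filter.Eventually.of_forall fun z => ?_)
    simp
  exact PreconnectedSpace.constant inferInstance hc

theorem IsFlat.eq_of_eq [PreconnectedSpace Y] {f : Y → X} (hf : Continuous f) {s s' : Y → H}
    (h : 𝒜.IsFlat f s) (h' : 𝒜.IsFlat f s') {y : Y} (hy : s y = s' y) : s = s' := by
  funext z
  have := h.eq_mul hf h' y z
  rw [hy, mul_inv_cancel] at this
  exact (mul_inv_eq_one.mp this.symm)

variable (𝒜)

/-- The bundle of a flat atlas. -/
noncomputable def core : FiberBundleCore ι X H where
  baseSet := 𝒜.U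
  isOpen_baseSet := 𝒜.isOpen_U
  indexAt x := (𝒜.cover x).choose
  mem_baseSet_at x := (𝒜.cover x).choose_spec
  coordChange i j x h := h * ((𝒜.sec i x)⁻¹ * 𝒜.sec j x)
  coordChange_self i x _ v := by simp
  continuousOn_coordChange i j := by
    have h1 : ContinuousOn (fun p : X × H => (p.2, (𝒜.sec i p.1)⁻¹ * 𝒜.sec j p.1))
        ((𝒜.U i ∩ 𝒜.U j) ×ˢ Set.univ) :=
      continuous_snd.continuousOn.prodMk
        ((𝒜.compat i j).comp continuous_fst.continuousOn fun p hp => hp.1)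
    exact (continuous_of_discreteTopology (f := fun p : H × H => p.1 * p.2)).comp_continuousOn h1
  coordChange_comp i j k x _ v := by group

theorem isCoveringMap_core : IsCoveringMap 𝒜.core.proj :=
  FiberBundle.isCoveringMap (F := H) (E := 𝒜.core.Fiber)

theorem exists_isFlat_of_lift {f : Y → X} (F : C(Y, 𝒜.core.TotalSpace))
    (hF : 𝒜.core.proj ∘ F = f) : ∃ s : Y → H, 𝒜.IsFlat f s := by
  subst hF
  -- The fibre coordinate is read in the chart `indexAt`; dividing by `sec` of that chart makes it
  -- independent of the chart.
  refine ⟨fun y => (show H from (F y).2) * (𝒜.sec (𝒜.core.indexAt (F y).1) (F y).1)⁻¹, fun i => ?_⟩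
  have h1 : ContinuousOn (fun y => (𝒜.core.localTriv i (F y)).2)
      ((𝒜.core.proj ∘ F) ⁻¹' 𝒜.U i) :=
    continuous_snd.comp_continuousOn
      ((𝒜.core.localTriv i).continuousOn_toFun.comp F.continuous.continuousOn fun y hy => hy)
  refine h1.congr fun y _ => ?_
  exact mul_assoc _ _ _

theorem exists_isFlat_path (γ : C(I, X)) : ∃ s : I → H, 𝒜.IsFlat γ s ∧ s 0 = 1 := by
  have cov := 𝒜.isCoveringMap_core
  obtain ⟨s, hs⟩ := 𝒜.exists_isFlat_of_lift
    (cov.liftPath γ (⟨γ 0, (1 : H)⟩ : 𝒜.core.TotalSpace) rfl)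
    (cov.liftPath_lifts _ _ _)
  exact ⟨_, hs.mul_left (s 0)⁻¹, by simp⟩

theorem exists_isFlat_square (F : C(I × I, X)) : ∃ s : I × I → H, 𝒜.IsFlat F s ∧ s 0 = 1 := by
  have cov := 𝒜.isCoveringMap_core
  -- One side of the square is lifted first; homotopy lifting then extends the lift over the whole
  -- square.
  let γ : C(I, X) := F.comp ⟨fun t => (0, t), by fun_prop⟩
  have h0 := cov.liftPath_lifts γ (⟨γ 0, (1 : H)⟩ : 𝒜.core.TotalSpace) rfl
  obtain ⟨s, hs⟩ := 𝒜.exists_isFlat_of_lift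
    (cov.liftHomotopy F (cov.liftPath γ (⟨γ 0, (1 : H)⟩ : 𝒜.core.TotalSpace) rfl)
      fun a => (congr_fun h0 a).symm)
    (cov.liftHomotopy_lifts _ _ _)
  exact ⟨_, hs.mul_left (s 0)⁻¹, by simp⟩

/-! ### Holonomy along paths and its homotopy invariance -/

/-- The flat section along a path that starts at `1`. -/
noncomputable def lift (γ : C(I, X)) : I → H := (𝒜.exists_isFlat_path γ).choose

theorem isFlat_lift (γ : C(I, X)) : 𝒜.IsFlat γ (𝒜.lift γ) := (𝒜.exists_isFlat_path γ).choose_spec.1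

@[simp] theorem lift_zero (γ : C(I, X)) : 𝒜.lift γ 0 = 1 := (𝒜.exists_isFlat_path γ).choose_spec.2

/-- The holonomy of a path. -/
noncomputable def hol {x y : X} (γ : Path x y) : H := 𝒜.lift γ.toContinuousMap 1

variable {𝒜}

theorem IsFlat.hol_eq {x y : X} {γ : Path x y} {s : I → H} (hs : 𝒜.IsFlat γ s) :
    𝒜.hol γ = (s 0)⁻¹ * s 1 := by
  have h := IsFlat.eq_of_eq γ.continuous (𝒜.isFlat_lift γ.toContinuousMap)
    (hs.mul_left (s 0)⁻¹) (y := 0) (by simp)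
  exact congr_fun h 1

variable (𝒜)

/-- The two halves of a flat section along the concatenation are flat along the two factors, and
they agree at the midpoint. -/
theorem hol_trans {x y z : X} (γ : Path x y) (δ : Path y z) :
    𝒜.hol (γ.trans δ) = 𝒜.hol γ * 𝒜.hol δ := by
  set s := 𝒜.lift (γ.trans δ).toContinuousMap with hs
  have hf := 𝒜.isFlat_lift (γ.trans δ).toContinuousMap
  have h1 : 𝒜.IsFlat γ (fun t : I => s ⟨t / 2, by constructor <;> linarith [t.2.1, t.2.2]⟩) := by
    refine (hf.comp (g := fun t : I =>
      (⟨t / 2, by constructor <;> linarith [t.2.1, t.2.2]⟩ : I)) (by fun_prop)).congr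
      (fun t => ?_) fun _ => rfl
    have : (t : ℝ) / 2 ≤ 1 / 2 := by linarith [t.2.2]
    simp only [Function.comp, Path.coe_toContinuousMap, Path.trans_apply, this, dite_true]
    congr 1
    ext
    simp only []
    ring
  have h2 : 𝒜.IsFlat δ
      (fun t : I => s ⟨(1 + t) / 2, by constructor <;> linarith [t.2.1, t.2.2]⟩) := by
    refine (hf.comp (g := fun t : I =>
      (⟨(1 + t) / 2, by constructor <;> linarith [t.2.1, t.2.2]⟩ : I)) (by fun_prop)).congr
      (fun t => ?_) fun _ => rfl
    simp only [Function.comp, Path.coe_toContinuousMap, Path.trans_apply]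
    split_ifs with h
    · have : t = 0 := by
        ext
        simp only [Set.Icc.coe_zero]
        linarith [t.2.1]
      subst this
      simp
    · congr 1
      ext
      simp only []
      ring
  rw [h1.hol_eq, h2.hol_eq]
  have e0 : s ⟨((0 : I) : ℝ) / 2, by norm_num⟩ = 1 := by
    rw [← 𝒜.lift_zero (γ.trans δ).toContinuousMap]
    congr 1
    ext
    simp
  have e1 : s ⟨(1 + ((0 : I) : ℝ)) / 2, by norm_num⟩ = s ⟨((1 : I) : ℝ) / 2, by norm_num⟩ := by
    congr 1
    ext
    simp
  have e2 : s ⟨(1 + ((1 : I) : ℝ)) / 2, by norm_num⟩ = s 1 := by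
    congr 1
    ext
    norm_num
  rw [e0, e1, e2]
  simp [hol, hs]

/-- A flat section over the square of the homotopy restricts to flat sections along both paths. It
is constant on the two sides where the endpoints are held fixed. -/
theorem hol_eq_of_homotopic {x y : X} {γ δ : Path x y} (h : γ.Homotopic δ) :
    𝒜.hol γ = 𝒜.hol δ := by
  obtain ⟨F⟩ := h
  obtain ⟨s, hs, h0⟩ := 𝒜.exists_isFlat_square F.toContinuousMap
  have hγ : 𝒜.IsFlat γ (fun t => s (0, t)) :=
    (hs.comp (g := fun t : I => ((0 : I), t)) (by fun_prop)).congr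
      (fun t => (F.apply_zero t).symm) fun _ => rfl
  have hδ : 𝒜.IsFlat δ (fun t => s (1, t)) :=
    (hs.comp (g := fun t : I => ((1 : I), t)) (by fun_prop)).congr
      (fun t => (F.apply_one t).symm) fun _ => rfl
  have hconst (z : X) (g : I → I × I) (hg : Continuous g) (hz : ∀ t, F (g t) = z) :
      s (g 0) = s (g 1) := by
    have h1 := hs.comp hg
    have h2 : 𝒜.IsFlat (F ∘ g) (fun _ => s (g 0)) := by
      intro i
      have : F ∘ g = fun _ => z := funext hz
      rw [this]
      exact continuousOn_const
    exact (congr_fun (IsFlat.eq_of_eq (F.continuous.comp hg) h1 h2 (y := 0) rfl) 1).symm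
  have a0 := hconst x (fun t => (t, 0)) (by fun_prop) fun t => F.source t
  have a1 := hconst y (fun t => (t, 1)) (by fun_prop) fun t => F.target t
  rw [hγ.hol_eq, hδ.hol_eq]
  exact congr_arg₂ (fun a b => a⁻¹ * b) a0 a1

end FlatAtlas

/-! ### Homotopy classes of paths -/

theorem Path.homotopic_of_factor {X Y : Type*} [TopologicalSpace X] [TopologicalSpace Y]
    [SimplyConnectedSpace Y] (Φ : C(Y, X)) {x y : X} {a b : Y} (δ δ' : Path a b)
    {γ γ' : Path x y} (h : ∀ t, γ t = Φ (δ t)) (h' : ∀ t, γ' t = Φ (δ' t)) : γ.Homotopic γ' := by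
  obtain rfl : Φ a = x := by rw [← γ.source, h, δ.source]
  obtain rfl : Φ b = y := by rw [← γ.target, h, δ.target]
  obtain rfl : γ = δ.map Φ.continuous := Path.ext (funext h)
  obtain rfl : γ' = δ'.map Φ.continuous := Path.ext (funext h')
  exact (SimplyConnectedSpace.paths_homotopic δ δ').map Φ

theorem Convex.simplyConnectedSpace {E : Type*} [AddCommGroup E] [Module ℝ E] [TopologicalSpace E]
    [ContinuousAdd E] [ContinuousSMul ℝ E] {s : Set E} (hs : Convex ℝ s) (hne : s.Nonempty) :
    SimplyConnectedSpace s :=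
  have := hs.contractibleSpace hne
  inferInstance

instance unitInterval.simplyConnectedSpace : SimplyConnectedSpace I :=
  (convex_Icc (0 : ℝ) 1).simplyConnectedSpace ⟨0, by simp⟩

instance unitInterval.simplyConnectedSpace_prod : SimplyConnectedSpace (I × I) :=
  have := (convex_Icc (0 : ℝ) 1).contractibleSpace ⟨0, by simp⟩
  have h : ((Set.Icc (0 : ℝ) 1) ×ˢ (Set.Icc (0 : ℝ) 1)).Nonempty := ⟨(0, 0), by simp⟩
  have := ((convex_Icc (0 : ℝ) 1).prod (convex_Icc (0 : ℝ) 1)).contractibleSpace h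
  have : ContractibleSpace (I × I) :=
    (Homeomorph.Set.prod (Set.Icc (0 : ℝ) 1) (Set.Icc (0 : ℝ) 1)).symm.contractibleSpace
  inferInstance

/-- The two ways around a square are homotopic. -/
theorem Path.homotopic_of_square {X : Type*} [TopologicalSpace X] (K : C(I × I, X)) {a b c d : X}
    {bot : Path a b} {top : Path c d} {left : Path a c} {right : Path b d}
    (hb : ∀ t, bot t = K (0, t)) (ht : ∀ t, top t = K (1, t)) (hl : ∀ t, left t = K (t, 0))
    (hr : ∀ t, right t = K (t, 1)) : (left.trans top).Homotopic (bot.trans right) := by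
  let B : Path ((0 : I), (0 : I)) (0, 1) := ⟨⟨fun t => (0, t), by fun_prop⟩, rfl, rfl⟩
  let T : Path ((1 : I), (0 : I)) (1, 1) := ⟨⟨fun t => (1, t), by fun_prop⟩, rfl, rfl⟩
  let L : Path ((0 : I), (0 : I)) (1, 0) := ⟨⟨fun t => (t, 0), by fun_prop⟩, rfl, rfl⟩
  let R : Path ((0 : I), (1 : I)) (1, 1) := ⟨⟨fun t => (t, 1), by fun_prop⟩, rfl, rfl⟩
  obtain rfl : K (0, 0) = a := by rw [← hb, bot.source]
  obtain rfl : K (0, 1) = b := by rw [← hb, bot.target]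
  obtain rfl : K (1, 0) = c := by rw [← ht, top.source]
  obtain rfl : K (1, 1) = d := by rw [← ht, top.target]
  obtain rfl : bot = B.map K.continuous := Path.ext (funext hb)
  obtain rfl : top = T.map K.continuous := Path.ext (funext ht)
  obtain rfl : left = L.map K.continuous := Path.ext (funext hl)
  obtain rfl : right = R.map K.continuous := Path.ext (funext hr)
  rw [← Path.map_trans, ← Path.map_trans]
  exact (SimplyConnectedSpace.paths_homotopic _ _).map K

/-- A property of paths that is invariant under homotopy and compatible with concatenation holds
for all paths if it holds for the paths inside the members of an open cover. -/
theorem Path.induction_of_cover {X ι : Type*} [TopologicalSpace X] {U : ι → Set X}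
    (hU : ∀ i, IsOpen (U i)) (hcov : ∀ x, ∃ i, x ∈ U i) {P : ∀ {x y : X}, Path x y → Prop}
    (htrans : ∀ {x y z : X} {γ : Path x y} {δ : Path y z}, P γ → P δ → P (γ.trans δ))
    (hhom : ∀ {x y : X} {γ δ : Path x y}, γ.Homotopic δ → P γ → P δ)
    (hP : ∀ i {x y : X} (γ : Path x y), (∀ t, γ t ∈ U i) → P γ) {x y : X} (γ : Path x y) : P γ := by
  -- A Lebesgue subdivision: each piece of the path lies in one member of the cover, and the pieces
  -- are concatenated by induction.
  obtain ⟨t, t0, tm, ⟨N, hN⟩, ht⟩ := exists_monotone_Icc_subset_open_cover_unitInterval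
    (c := fun i => γ ⁻¹' U i) (fun i => (hU i).preimage γ.continuous)
    (fun s _ => Set.mem_iUnion.mpr (hcov (γ s)))
  have key (n : ℕ) : P (γ.subpath 0 (t n)) := by
    induction n with
    | zero =>
      obtain ⟨i, hi⟩ := hcov (γ 0)
      rw [t0, Path.subpath_self]
      exact hP i _ fun _ => hi
    | succ n ih =>
      refine hhom ⟨Path.Homotopy.subpathTransSubpath γ 0 (t n) (t (n + 1))⟩ (htrans ih ?_)
      obtain ⟨i, hi⟩ := ht n
      refine hP i _ fun s => ?_
      have hs : γ.subpath (t n) (t (n + 1)) s ∈ Set.range (γ.subpath (t n) (t (n + 1))) := ⟨s, rfl⟩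
      rw [Path.range_subpath_of_le _ _ _ (tm n.le_succ)] at hs
      obtain ⟨r, hr, hrs⟩ := hs
      rw [← hrs]
      exact hi hr
  have h1 := key N
  rw [hN N le_rfl, Path.subpath_zero_one] at h1
  have hcast {x' y' : X} (hx : x' = x) (hy : y' = y) (h : P (γ.cast hx hy)) : P γ := by
    subst hx hy
    exact h
  exact hcast _ _ h1

theorem Path.Homotopic.Quotient.symm_trans_cancel_left {X : Type*} [TopologicalSpace X] {x y z : X}
    (γ : Path.Homotopic.Quotient x y) (δ : Path.Homotopic.Quotient y z) :
    γ.symm.trans (γ.trans δ) = δ := by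
  rw [← trans_assoc, symm_trans, refl_trans]

/-- A homotopy invariant of paths with values in a group, multiplicative under concatenation. -/
structure PathFunctional (X H : Type*) [TopologicalSpace X] [Group H] where
  toFun : ∀ {x y : X}, Path x y → H
  map_homotopic : ∀ {x y : X} {γ δ : Path x y}, γ.Homotopic δ → toFun γ = toFun δ
  map_trans : ∀ {x y z : X} (γ : Path x y) (δ : Path y z), toFun (γ.trans δ) = toFun γ * toFun δ

namespace PathFunctional

variable {X Y H : Type*} [TopologicalSpace X] [TopologicalSpace Y] [Group H]
  (T : PathFunctional X H)

theorem map_refl (x : X) : T.toFun (Path.refl x) = 1 := by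
  have h := T.map_trans (Path.refl x) (Path.refl x)
  rw [T.map_homotopic ⟨Path.Homotopy.transRefl (Path.refl x)⟩] at h
  exact (left_eq_mul.mp h)

theorem map_symm {x y : X} (γ : Path x y) : T.toFun γ.symm = (T.toFun γ)⁻¹ := by
  rw [eq_inv_iff_mul_eq_one, ← T.map_trans, ← T.map_refl y]
  exact T.map_homotopic ⟨(Path.Homotopy.reflSymmTrans γ).symm⟩

/-- The restriction of a path functional along a continuous map. -/
def comap (f : C(Y, X)) : PathFunctional Y H where
  toFun γ := T.toFun (γ.map f.continuous)
  map_homotopic h := T.map_homotopic (h.map f)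
  map_trans γ δ := by rw [Path.map_trans, T.map_trans]

/-- The homomorphism from the fundamental group, with paths multiplied from left to right. -/
def toMonoidHom (x : X) : (FundamentalGroup X x)ᵐᵒᵖ →* H where
  toFun α := Quotient.liftOn α.unop.toPath (fun γ => T.toFun γ) fun _ _ h => T.map_homotopic h
  map_one' := T.map_refl x
  map_mul' := by
    rintro ⟨α⟩ ⟨β⟩
    induction α using Quotient.ind with | _ γ =>
    induction β using Quotient.ind with | _ δ =>
    exact T.map_trans γ δ

/-- A homomorphism from the fundamental group, with paths multiplied from left to right, extends
to a path functional after a choice of paths from the base point to all points. -/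
noncomputable def ofMonoidHom {x₀ : X} (φ : (FundamentalGroup X x₀)ᵐᵒᵖ →* H)
    (Q : ∀ x, Path x₀ x) : PathFunctional X H where
  toFun {x y} γ := φ (.op (FundamentalGroup.fromPath
    (.mk (((Q x).trans γ).trans (Q y).symm))))
  map_homotopic h := by
    congr 3
    exact Path.Homotopic.Quotient.eq.mpr (((Path.Homotopic.refl _).hcomp h).hcomp (.refl _))
  map_trans {x y z} γ δ := by
    rw [← map_mul, ← MulOpposite.op_mul]
    congr 2
    change _ = Path.Homotopic.Quotient.trans _ _
    simp only [FundamentalGroup.fromPath, FundamentalGroup.fromArrow,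
      Path.Homotopic.Quotient.mk_trans, Path.Homotopic.Quotient.mk_symm]
    simp only [Path.Homotopic.Quotient.trans_assoc,
      Path.Homotopic.Quotient.symm_trans_cancel_left]

end PathFunctional

/-- The holonomy of a flat atlas. -/
noncomputable def FlatAtlas.functional {ι X H : Type*} [TopologicalSpace X] [Group H]
    [TopologicalSpace H] [DiscreteTopology H] (𝒜 : FlatAtlas ι X H) : PathFunctional X H where
  toFun γ := 𝒜.hol γ
  map_homotopic h := 𝒜.hol_eq_of_homotopic h
  map_trans γ δ := 𝒜.hol_trans γ δ

/-! ### Path-connectedness of a connected complex -/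

namespace TwoComplex

variable {E : Type u} {F : Type v} (X : TwoComplex.{u, v, w} E F)

/-- Intervals and disks are locally path connected, and this passes to disjoint unions and
quotients. -/
theorem pathConnectedSpace [ConnectedSpace X.Space] : PathConnectedSpace X.Space := by
  have := (convex_Icc (0 : ℝ) 1).locallyPathConnectedSpace
  have := (convex_closedBall (0 : ℂ) 1).locallyPathConnectedSpace
  have : LocallyPathConnectedSpace X.Skeleton :=
    inferInstanceAs (LocallyPathConnectedSpace (Quot X.EdgeGlue))
  have : LocallyPathConnectedSpace X.Space :=
    inferInstanceAs (LocallyPathConnectedSpace (Quot X.FaceGlue))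
  exact pathConnectedSpace_iff_connectedSpace.mpr inferInstance

end TwoComplex

/-! ### The 1-skeleton -/

theorem Path.trans_factor {X Y : Type*} [TopologicalSpace X] [TopologicalSpace Y] {f : Y → X}
    {x y z : X} {a b c : Y} {γ : Path x y} {γ' : Path y z} {δ : Path a b} {δ' : Path b c}
    (h : ∀ t, γ t = f (δ t)) (h' : ∀ t, γ' t = f (δ' t)) (t : I) :
    (γ.trans γ') t = f ((δ.trans δ') t) := by
  simp only [Path.trans_apply]
  split_ifs
  · exact h _
  · exact h' _

/-- The only possible jump is at the midpoint, which `S` avoids. -/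
theorem continuousOn_ite_half_lt {Z : Type*} [TopologicalSpace Z] {f g : I → Z} (hf : Continuous f)
    (hg : Continuous g) {S : Set I} (hS : ∀ t ∈ S, (t : ℝ) ≠ 1 / 2) :
    ContinuousOn (fun t : I => if (1 / 2 : ℝ) < t then f t else g t) S := by
  intro t ht
  refine ContinuousAt.continuousWithinAt ?_
  rcases lt_or_gt_of_ne (hS t ht) with h | h
  · refine hg.continuousAt.congr ?_
    filter_upwards [(isOpen_lt continuous_subtype_val continuous_const).mem_nhds h] with s hs
    rw [if_neg (not_lt.mpr (le_of_lt hs))]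
  · refine hf.continuousAt.congr ?_
    filter_upwards [(isOpen_lt continuous_const continuous_subtype_val).mem_nhds h] with s hs
    rw [if_pos hs]

namespace EdgePath

variable {V E : Type*} {src tgt : E → V}

/-- Concatenation of edge paths. -/
def append : {u v w : V} → EdgePath src tgt u v → EdgePath src tgt v w → EdgePath src tgt u w
  | _, _, _, nil _, q => q
  | _, _, _, fwd e p, q => fwd e (p.append q)
  | _, _, _, bwd e p, q => bwd e (p.append q)

theorem eval_nil {G : Type*} [Group G] (g : E → G) (v : V) :
    (nil v : EdgePath src tgt v v).eval g = 1 := rfl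

theorem eval_fwd {G : Type*} [Group G] (g : E → G) (e : E) {w : V}
    (p : EdgePath src tgt (tgt e) w) : (fwd e p).eval g = g e * p.eval g := by
  simp [eval, word]

theorem eval_bwd {G : Type*} [Group G] (g : E → G) (e : E) {w : V}
    (p : EdgePath src tgt (src e) w) : (bwd e p).eval g = (g e)⁻¹ * p.eval g := by
  simp [eval, word]

end EdgePath

namespace TwoComplex

variable {E : Type u} {F : Type v} (X : TwoComplex.{u, v, w} E F)

/-- Functions on the 1-skeleton. -/
def skelLift {Z : Type*} (a : X.V → Z) (b : E → I → Z) (h0 : ∀ e, b e 0 = a (X.src e))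
    (h1 : ∀ e, b e 1 = a (X.tgt e)) : X.Skeleton → Z :=
  Quot.lift (Sum.elim (fun v => a v.1) fun x => b x.1 x.2) fun _ _ h => by
    cases h with
    | src e => exact h0 e
    | tgt e => exact h1 e

theorem skel_ind {P : X.Skeleton → Prop} (hv : ∀ v, P (X.skelVert v))
    (he : ∀ e (t : I), t ≠ 0 → t ≠ 1 → P (X.edge e t)) (x : X.Skeleton) : P x := by
  induction x using Quot.ind with | _ x =>
  rcases x with ⟨v, ⟨⟩⟩ | ⟨e, t⟩
  · exact hv v
  · change P (X.edge e t)
    by_cases h0 : t = 0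
    · rw [h0, (X.edge e).source]
      exact hv _
    by_cases h1 : t = 1
    · rw [h1, (X.edge e).target]
      exact hv _
    exact he e t h0 h1

/-- The vertices carry the discrete topology, so in the quotient topology they impose no condition
of their own. -/
theorem isOpen_skeleton_iff {S : Set X.Skeleton} :
    IsOpen S ↔ ∀ e, IsOpen (X.edge e ⁻¹' S) := by
  refine ⟨fun h e => h.preimage (X.edge e).continuous, fun h => ?_⟩
  refine (isQuotientMap_quot_mk (r := X.EdgeGlue)).isOpen_preimage.mp
    (isOpen_sum_iff.mpr ⟨?_, isOpen_sigma_iff.mpr h⟩)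
  rw [isOpen_sigma_iff]
  exact fun _ => isOpen_discrete _

theorem continuousOn_skeleton {Z : Type*} [TopologicalSpace Z] {g : X.Skeleton → Z}
    {S : Set X.Skeleton} (hS : IsOpen S)
    (h : ∀ e, ContinuousOn (fun t : I => g (X.edge e t)) (X.edge e ⁻¹' S)) : ContinuousOn g S := by
  rw [continuousOn_open_iff hS]
  intro T hT
  rw [isOpen_skeleton_iff]
  intro e
  exact (continuousOn_open_iff (hS.preimage (X.edge e).continuous)).mp (h e) T hT

/-- The complement of the midpoints of the edges. -/
def skelU : Set X.Skeleton :=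
  {x | X.skelLift (fun _ => True) (fun _ t => (t : ℝ) ≠ 1 / 2) (by simp) (by norm_num) x}

/-- The union of the open edges. -/
def skelW : Set X.Skeleton :=
  {x | X.skelLift (fun _ => False) (fun _ t => t ≠ 0 ∧ t ≠ 1) (by simp) (by simp) x}

theorem skelVert_mem_skelU (v : X.V) : X.skelVert v ∈ X.skelU := trivial

theorem isOpen_skelU : IsOpen X.skelU := X.isOpen_skeleton_iff.mpr fun _ =>
  isOpen_ne_fun continuous_subtype_val continuous_const

theorem isOpen_skelW : IsOpen X.skelW := X.isOpen_skeleton_iff.mpr fun _ =>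
  (isOpen_ne_fun continuous_id continuous_const).inter (isOpen_ne_fun continuous_id continuous_const)

theorem mem_skelU_or_mem_skelW (x : X.Skeleton) : x ∈ X.skelU ∨ x ∈ X.skelW := by
  induction x using X.skel_ind with
  | hv v => exact .inl (X.skelVert_mem_skelU v)
  | he e t h0 h1 => exact .inr ⟨h0, h1⟩

/-! #### The flat atlas of a labelling of the edges -/

section Atlas

variable {H : Type*} [Group H] (h : E → H)

open Classical in
/-- The comparison function on the complement of the midpoints. -/
noncomputable def skelSec : X.Skeleton → H :=
  -- The jump at the midpoint is outside the chart. The value at `t = 1` must return to `1` for the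
  -- function to be well defined at the target vertex; the resulting discontinuity there carries the
  -- holonomy.
  X.skelLift (fun _ => 1) (fun e t => if (1 / 2 : ℝ) < t then (if t = 1 then 1 else h e) else 1)
    (by intro e; norm_num) (by intro e; norm_num)

open Classical in
theorem skelSec_edge (e : E) (t : I) : X.skelSec h (X.edge e t) =
    if (1 / 2 : ℝ) < t then (if t = 1 then 1 else h e) else 1 := rfl

variable [TopologicalSpace H]

theorem continuousOn_skelSec : ContinuousOn (X.skelSec h) (X.skelU ∩ X.skelW) := by
  refine X.continuousOn_skeleton (X.isOpen_skelU.inter X.isOpen_skelW) fun e => ?_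
  have := continuousOn_ite_half_lt (S := X.edge e ⁻¹' (X.skelU ∩ X.skelW))
    (continuous_const (y := h e)) (continuous_const (y := (1 : H))) fun t ht => ht.1
  refine this.congr fun t ht => ?_
  rw [skelSec_edge, if_neg ht.2.2]

/-- The flat atlas on the 1-skeleton with holonomy `h e` along the edge `e`. -/
noncomputable def skelAtlas [DiscreteTopology H] : FlatAtlas Bool X.Skeleton H where
  U b := if b then X.skelU else X.skelW
  isOpen_U b := by
    cases b
    exacts [X.isOpen_skelW, X.isOpen_skelU]
  cover x := (X.mem_skelU_or_mem_skelW x).elim (fun h => ⟨true, h⟩) fun h => ⟨false, h⟩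
  sec b := if b then X.skelSec h else fun _ => 1
  compat i j := by
    rcases i with _ | _ <;> rcases j with _ | _
    · simpa using continuousOn_const
    · simpa [Set.inter_comm] using X.continuousOn_skelSec h
    · simpa [Function.comp_def] using (continuous_of_discreteTopology
        (f := fun x : H => x⁻¹)).comp_continuousOn (X.continuousOn_skelSec h)
    · simpa using continuousOn_const

theorem hol_edge [DiscreteTopology H] (e : E) : (X.skelAtlas h).hol (X.edge e) = h e := by
  classical
  -- The section is constant on the open edge. At `t = 1` the comparison function drops from `h e`
  -- to `1`, so the section must jump to `h e` to keep their product constant.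
  have hf : (X.skelAtlas h).IsFlat (X.edge e) (fun t : I => if t = 1 then h e else 1) := by
    intro i
    cases i
    · refine (continuousOn_const (c := (1 : H))).congr fun t ht => ?_
      have : t ≠ 1 := ht.2
      simp [skelAtlas, this]
    · refine (continuousOn_ite_half_lt (continuous_const (y := h e)) (continuous_const (y := (1 : H)))
        fun t ht => ht).congr fun t ht => ?_
      change _ * X.skelSec h (X.edge e t) = _
      rw [skelSec_edge]
      by_cases h1 : t = 1
      · subst h1
        norm_num
      · simp [h1]
  rw [hf.hol_eq]
  simp

end Atlas

/-! #### Edge paths as paths -/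

/-- `extend` associates concatenations to the left; reassociating them allows induction on the first
step of an edge path. -/
theorem extend_homotopic {x : X.Skeleton} {v w : X.V} (p : EdgePath X.src X.tgt v w)
    (γ : Path x (X.skelVert v)) : (X.extend p γ).Homotopic (γ.trans (X.skelPath p)) := by
  induction p generalizing x with
  | nil v => exact ⟨(Path.Homotopy.transRefl γ).symm⟩
  | fwd e p ih =>
    refine (ih _).trans (Path.Homotopic.trans ⟨Path.Homotopy.transAssoc _ _ _⟩ ?_)
    exact (Path.Homotopic.refl γ).hcomp (ih (X.edge e)).symm
  | bwd e p ih =>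
    refine (ih _).trans (Path.Homotopic.trans ⟨Path.Homotopy.transAssoc _ _ _⟩ ?_)
    exact (Path.Homotopic.refl γ).hcomp (ih (X.edge e).symm).symm

theorem skelPath_append {u v w : X.V} (p : EdgePath X.src X.tgt u v)
    (q : EdgePath X.src X.tgt v w) :
    (X.skelPath (p.append q)).Homotopic ((X.skelPath p).trans (X.skelPath q)) := by
  induction p with
  | nil v => exact ⟨(Path.Homotopy.reflTrans _).symm⟩
  | fwd e p ih =>
    refine (X.extend_homotopic _ _).trans (((Path.Homotopic.refl _).hcomp (ih q)).trans ?_)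
    refine Path.Homotopic.trans ⟨(Path.Homotopy.transAssoc _ _ _).symm⟩ ?_
    exact (X.extend_homotopic _ _).symm.hcomp (.refl _)
  | bwd e p ih =>
    refine (X.extend_homotopic _ _).trans (((Path.Homotopic.refl _).hcomp (ih q)).trans ?_)
    refine Path.Homotopic.trans ⟨(Path.Homotopy.transAssoc _ _ _).symm⟩ ?_
    exact (X.extend_homotopic _ _).symm.hcomp (.refl _)

theorem map_skelPath {H : Type*} [Group H] (T : PathFunctional X.Skeleton H) {v w : X.V}
    (p : EdgePath X.src X.tgt v w) :
    T.toFun (X.skelPath p) = p.eval fun e => T.toFun (X.edge e) := by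
  induction p with
  | nil v => exact T.map_refl _
  | fwd e p ih =>
    rw [EdgePath.eval_fwd, ← ih, ← T.map_trans]
    exact T.map_homotopic (X.extend_homotopic p _)
  | bwd e p ih =>
    rw [EdgePath.eval_bwd, ← ih, ← T.map_symm, ← T.map_trans]
    exact T.map_homotopic (X.extend_homotopic p _)

/-! #### Paths in the 1-skeleton are homotopic to edge paths -/

theorem exists_skelPath_eq_const {v w : X.V} (h : v = w) :
    ∃ p : EdgePath X.src X.tgt v w, ∀ t, X.skelPath p t = X.skelVert v := by
  subst h
  exact ⟨.nil v, fun _ => rfl⟩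

/-- Pointwise equality of the underlying paths avoids transporting edge paths along equalities of
vertices. -/
theorem exists_skelPath_congr {v w v' w' : X.V} (hv : v = v') (hw : w = w')
    (p : EdgePath X.src X.tgt v' w') :
    ∃ q : EdgePath X.src X.tgt v w, ∀ t, X.skelPath q t = X.skelPath p t := by
  subst hv hw
  exact ⟨p, fun _ => rfl⟩

/-! ### Path systems and the deformation of paths to edge paths -/

/-- For every point of the space, a path to it from a point of the form `f b`. -/
structure _root_.PathSystem {B S : Type*} [TopologicalSpace S] (f : B → S) where
  start : S → B
  path : S → C(I, S)
  path_zero : ∀ x, path x 0 = f (start x)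
  path_one : ∀ x, path x 1 = x

/-- The path to `x` of a path system. -/
def _root_.PathSystem.to {B S : Type*} [TopologicalSpace S] {f : B → S} (K : PathSystem f) (x : S) :
    Path (f (K.start x)) x where
  toContinuousMap := K.path x
  source' := K.path_zero x
  target' := K.path_one x

/-- Where `K.path` is continuous, the paths to the points `γ t` sweep out a square. Its sides are
`η`, `γ` and the paths to `x` and `y`. -/
theorem _root_.PathSystem.homotopic {B S : Type*} [TopologicalSpace S] {f : B → S}
    (K : PathSystem f) {U : Set S} (hK : ContinuousOn K.path U) {x y : S} (γ : Path x y)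
    (hγ : ∀ t, γ t ∈ U) {η : Path (f (K.start x)) (f (K.start y))}
    (hη : ∀ t, η t = f (K.start (γ t))) :
    ((K.to x).trans γ).Homotopic (η.trans (K.to y)) := by
  have hc : Continuous fun t => K.path (γ t) := hK.comp_continuous γ.continuous hγ
  let Φ : C(I × I, S) := ⟨fun q => K.path (γ q.2) q.1, by
    have := ContinuousMap.continuous_uncurry_of_continuous ⟨_, hc⟩
    exact this.comp continuous_swap⟩
  refine Path.homotopic_of_square Φ (fun t => ?_) (fun t => ?_) (fun t => ?_) fun t => ?_
  · exact (hη t).trans (K.path_zero _).symm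
  · exact (K.path_one _).symm
  · change K.path x t = K.path (γ 0) t
    rw [γ.source]
  · change K.path y t = K.path (γ 1) t
    rw [γ.target]

/-- The subpaths of the edge `e` that start at time `r`. -/
noncomputable def edgePart (e : E) (r t : I) : C(I, X.Skeleton) :=
  ((X.edge e).subpath r t).toContinuousMap

theorem continuous_edgePart (e : E) (r : I) : Continuous (X.edgePart e r) := by
  refine ContinuousMap.continuous_of_continuous_uncurry _ ?_
  have := (X.edge e).subpath_continuous_family
  exact this.comp (continuous_const.prodMk continuous_id)

theorem edgePart_self (e : E) (t : I) : X.edgePart e t t = .const I (X.edge e t) := by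
  rw [edgePart, Path.subpath_self]
  rfl

open Classical in
/-- The path system of initial parts of edges. -/
noncomputable def srcSystem : PathSystem X.skelVert where
  start := X.skelLift id (fun e t => if t = 1 then X.tgt e else X.src e) (by simp) (by simp)
  path := X.skelLift (fun v => .const I (X.skelVert v))
    (fun e t => if t = 1 then .const I (X.skelVert (X.tgt e)) else X.edgePart e 0 t)
    (fun e => by simp [edgePart_self]) (by simp)
  path_zero x := by
    induction x using X.skel_ind with
    | hv v => rfl
    | he e t h0 h1 =>
      change (if t = 1 then _ else X.edgePart e 0 t) 0 = X.skelVert (if t = 1 then _ else X.src e)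
      simp [h1, edgePart]
  path_one x := by
    induction x using X.skel_ind with
    | hv v => rfl
    | he e t h0 h1 =>
      change (if t = 1 then _ else X.edgePart e 0 t) 1 = _
      simp [h1, edgePart]

/-- The path system of straight paths from the nearest vertex. -/
noncomputable def starSystem : PathSystem X.skelVert where
  start := X.skelLift id (fun e t => if (1 / 2 : ℝ) < t then X.tgt e else X.src e)
    (by intro e; norm_num) (by intro e; norm_num)
  path := X.skelLift (fun v => .const I (X.skelVert v))
    (fun e t => if (1 / 2 : ℝ) < t then X.edgePart e 1 t else X.edgePart e 0 t)
    (fun e => by norm_num [edgePart_self]) (fun e => by norm_num [edgePart_self])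
  path_zero x := by
    induction x using X.skel_ind with
    | hv v => rfl
    | he e t h0 h1 =>
      change (if (1 / 2 : ℝ) < t then X.edgePart e 1 t else X.edgePart e 0 t) 0 =
        X.skelVert (if (1 / 2 : ℝ) < t then X.tgt e else X.src e)
      split_ifs <;> simp [edgePart]
  path_one x := by
    induction x using X.skel_ind with
    | hv v => rfl
    | he e t h0 h1 =>
      change (if (1 / 2 : ℝ) < t then X.edgePart e 1 t else X.edgePart e 0 t) 1 = _
      split_ifs <;> simp [edgePart]

open Classical in
theorem srcSystem_start_edge (e : E) (t : I) :
    X.srcSystem.start (X.edge e t) = if t = 1 then X.tgt e else X.src e := rfl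

open Classical in
theorem srcSystem_path_edge (e : E) (t : I) : X.srcSystem.path (X.edge e t) =
    if t = 1 then .const I (X.skelVert (X.tgt e)) else X.edgePart e 0 t := rfl

theorem starSystem_start_edge (e : E) (t : I) :
    X.starSystem.start (X.edge e t) = if (1 / 2 : ℝ) < t then X.tgt e else X.src e := rfl

theorem starSystem_path_edge (e : E) (t : I) : X.starSystem.path (X.edge e t) =
    if (1 / 2 : ℝ) < t then X.edgePart e 1 t else X.edgePart e 0 t := rfl

theorem continuousOn_srcSystem : ContinuousOn X.srcSystem.path X.skelW := by
  refine X.continuousOn_skeleton X.isOpen_skelW fun e => ?_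
  refine (X.continuous_edgePart e 0).continuousOn.congr fun t ht => ?_
  rw [srcSystem_path_edge, if_neg ht.2]

theorem continuousOn_starSystem : ContinuousOn X.starSystem.path X.skelU :=
  X.continuousOn_skeleton X.isOpen_skelU fun e =>
    continuousOn_ite_half_lt (X.continuous_edgePart e 1) (X.continuous_edgePart e 0) fun _ ht => ht

/-- On the open edges the starting vertex is locally constant, hence constant along a path. -/
theorem srcSystem_start_eq {x y : X.Skeleton} (γ : Path x y) (hγ : ∀ t, γ t ∈ X.skelW) (t : I) :
    X.srcSystem.start (γ t) = X.srcSystem.start x := by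
  let _ : TopologicalSpace X.V := ⊥
  have : DiscreteTopology X.V := ⟨rfl⟩
  have hc : ContinuousOn X.srcSystem.start X.skelW := by
    refine X.continuousOn_skeleton X.isOpen_skelW fun e => ?_
    refine (continuousOn_const (c := X.src e)).congr fun t ht => ?_
    rw [srcSystem_start_edge, if_neg ht.2]
  refine (PreconnectedSpace.constant inferInstance (hc.comp_continuous γ.continuous hγ)
    (x := t) (y := 0)).trans ?_
  rw [Function.comp, γ.source]

theorem starSystem_start_eq {x y : X.Skeleton} (γ : Path x y) (hγ : ∀ t, γ t ∈ X.skelU) (t : I) :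
    X.starSystem.start (γ t) = X.starSystem.start x := by
  let _ : TopologicalSpace X.V := ⊥
  have : DiscreteTopology X.V := ⟨rfl⟩
  have hc : ContinuousOn X.starSystem.start X.skelU :=
    X.continuousOn_skeleton X.isOpen_skelU fun e =>
      continuousOn_ite_half_lt (continuous_const (y := X.tgt e)) (continuous_const (y := X.src e))
        fun _ ht => ht
  refine (PreconnectedSpace.constant inferInstance (hc.comp_continuous γ.continuous hγ)
    (x := t) (y := 0)).trans ?_
  rw [Function.comp, γ.source]

/-- At a point of an edge both systems run inside that edge, which is the image of the simply
connected interval. They differ by the edge itself or by a trivial path. -/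
theorem exists_srcSystem_homotopic {x : X.Skeleton} (hx : x ∈ X.skelU) :
    (∃ p : EdgePath X.src X.tgt (X.srcSystem.start x) (X.starSystem.start x),
      (X.srcSystem.to x).Homotopic ((X.skelPath p).trans (X.starSystem.to x))) ∧
    ∃ p : EdgePath X.src X.tgt (X.starSystem.start x) (X.srcSystem.start x),
      (X.starSystem.to x).Homotopic ((X.skelPath p).trans (X.srcSystem.to x)) := by
  induction x using X.skel_ind with
  | hv v =>
    exact ⟨⟨.nil v, ⟨(Path.Homotopy.reflTrans _).symm⟩⟩, ⟨.nil v, ⟨(Path.Homotopy.reflTrans _).symm⟩⟩⟩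
  | he e t h0 h1 =>
    have hs : X.srcSystem.start (X.edge e t) = X.src e := by rw [srcSystem_start_edge, if_neg h1]
    let Φ : C(I, X.Skeleton) := (X.edge e).toContinuousMap
    -- The tautological path of the interval: parts of the edge are images of subpaths of `ζ`.
    let ζ : Path (0 : I) 1 := ⟨⟨id, continuous_id⟩, rfl, rfl⟩
    have hz (r : I) (a : I) : X.edgePart e r t a = Φ (ζ.subpath r t a) := rfl
    have hK (a : I) : X.srcSystem.to (X.edge e t) a = Φ (ζ.subpath 0 t a) := by
      change X.srcSystem.path (X.edge e t) a = _
      rw [srcSystem_path_edge, if_neg h1, hz]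
    by_cases h : (1 / 2 : ℝ) < t
    · have ht : X.starSystem.start (X.edge e t) = X.tgt e := by
        rw [starSystem_start_edge, if_pos h]
      have hK' (a : I) : X.starSystem.to (X.edge e t) a = Φ (ζ.subpath 1 t a) := by
        change X.starSystem.path (X.edge e t) a = _
        rw [starSystem_path_edge, if_pos h, hz]
      constructor
      · obtain ⟨p, hp⟩ := X.exists_skelPath_congr hs ht (.fwd e (.nil _))
        refine ⟨p, Path.homotopic_of_factor Φ (ζ.subpath 0 t) (ζ.trans (ζ.subpath 1 t)) hK ?_⟩
        exact Path.trans_factor (fun a => hp a) hK'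
      · obtain ⟨p, hp⟩ := X.exists_skelPath_congr ht hs (.bwd e (.nil _))
        refine ⟨p, Path.homotopic_of_factor Φ (ζ.subpath 1 t) (ζ.symm.trans (ζ.subpath 0 t)) hK' ?_⟩
        exact Path.trans_factor (fun a => hp a) hK
    · have ht : X.starSystem.start (X.edge e t) = X.src e := by
        rw [starSystem_start_edge, if_neg h]
      have hK' (a : I) : X.starSystem.to (X.edge e t) a = Φ (ζ.subpath 0 t a) := by
        change X.starSystem.path (X.edge e t) a = _
        rw [starSystem_path_edge, if_neg h, hz]
      have hc (a : I) : X.skelPath (.nil (X.src e)) a = Φ (Path.refl (0 : I) a) :=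
        (X.edge e).source.symm
      constructor
      · obtain ⟨p, hp⟩ := X.exists_skelPath_congr hs ht (.nil _)
        refine ⟨p, Path.homotopic_of_factor Φ (ζ.subpath 0 t) ((Path.refl 0).trans (ζ.subpath 0 t))
          hK ?_⟩
        exact Path.trans_factor (fun a => (hp a).trans (hc a)) hK'
      · obtain ⟨p, hp⟩ := X.exists_skelPath_congr ht hs (.nil _)
        refine ⟨p, Path.homotopic_of_factor Φ (ζ.subpath 0 t) ((Path.refl 0).trans (ζ.subpath 0 t))
          hK' ?_⟩
        exact Path.trans_factor (fun a => (hp a).trans (hc a)) hK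

/-- Prefixing and suffixing with `srcSystem` gives the claim a meaning for arbitrary endpoints, so
it can be checked on the members of an open cover. -/
theorem exists_edgePath_srcSystem {x y : X.Skeleton} (γ : Path x y) :
    ∃ p : EdgePath X.src X.tgt (X.srcSystem.start x) (X.srcSystem.start y),
      ((X.srcSystem.to x).trans γ).Homotopic ((X.skelPath p).trans (X.srcSystem.to y)) := by
  refine Path.induction_of_cover (U := fun b : Bool => if b then X.skelU else X.skelW)
    (P := fun {x y} γ => ∃ p : EdgePath X.src X.tgt (X.srcSystem.start x) (X.srcSystem.start y),
      ((X.srcSystem.to x).trans γ).Homotopic ((X.skelPath p).trans (X.srcSystem.to y)))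
    ?_ ?_ ?_ ?_ ?_ γ
  · rintro (_ | _)
    exacts [X.isOpen_skelW, X.isOpen_skelU]
  · exact fun x => (X.mem_skelU_or_mem_skelW x).elim (fun h => ⟨true, h⟩) fun h => ⟨false, h⟩
  · rintro x y z γ δ ⟨p, hp⟩ ⟨q, hq⟩
    refine ⟨p.append q, ?_⟩
    have hpq := X.skelPath_append p q
    rw [← Path.Homotopic.Quotient.eq] at hp hq hpq ⊢
    simp only [Path.Homotopic.Quotient.mk_trans] at hp hq hpq ⊢
    rw [hpq, Path.Homotopic.Quotient.trans_assoc, ← hq, ← Path.Homotopic.Quotient.trans_assoc, hp,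
      Path.Homotopic.Quotient.trans_assoc]
  · rintro x y γ δ h ⟨p, hp⟩
    exact ⟨p, ((Path.Homotopic.refl _).hcomp h.symm).trans hp⟩
  · rintro (_ | _) x y γ hγ
    · obtain ⟨p, hp⟩ := X.exists_skelPath_eq_const
        (by simpa using (X.srcSystem_start_eq γ hγ 1).symm :
          X.srcSystem.start x = X.srcSystem.start y)
      refine ⟨p, X.srcSystem.homotopic X.continuousOn_srcSystem γ hγ fun t => ?_⟩
      rw [hp, X.srcSystem_start_eq γ hγ]
    · obtain ⟨p, hp⟩ := X.exists_skelPath_eq_const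
        (by simpa using (X.starSystem_start_eq γ hγ 1).symm :
          X.starSystem.start x = X.starSystem.start y)
      have h2 := X.starSystem.homotopic X.continuousOn_starSystem γ hγ (η := X.skelPath p)
        fun t => by rw [hp, X.starSystem_start_eq γ hγ]
      -- Near vertices only `starSystem` is continuous, so the systems are exchanged at both ends at
      -- the cost of edge paths `q` and `r`.
      obtain ⟨q, h1⟩ := (X.exists_srcSystem_homotopic (by simpa using hγ 0 : x ∈ X.skelU)).1
      obtain ⟨r, h3⟩ := (X.exists_srcSystem_homotopic (by simpa using hγ 1 : y ∈ X.skelU)).2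
      refine ⟨q.append (p.append r), ?_⟩
      have e1 := X.skelPath_append q (p.append r)
      have e2 := X.skelPath_append p r
      rw [← Path.Homotopic.Quotient.eq] at h1 h2 h3 e1 e2 ⊢
      simp only [Path.Homotopic.Quotient.mk_trans] at h1 h2 h3 e1 e2 ⊢
      rw [e1, e2, h1, Path.Homotopic.Quotient.trans_assoc, h2, h3]
      simp only [Path.Homotopic.Quotient.trans_assoc]

/-- A path in the 1-skeleton between vertices is homotopic to an edge path. -/
theorem exists_skelPath_homotopic {v w : X.V} (γ : Path (X.skelVert v) (X.skelVert w)) :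
    ∃ p : EdgePath X.src X.tgt v w, γ.Homotopic (X.skelPath p) := by
  obtain ⟨p, hp⟩ := X.exists_edgePath_srcSystem γ
  refine ⟨p, ?_⟩
  have h1 : ((Path.refl _).trans γ).Homotopic ((X.skelPath p).trans (Path.refl _)) := hp
  exact (Path.Homotopic.trans ⟨(Path.Homotopy.reflTrans γ).symm⟩ h1).trans
    ⟨Path.Homotopy.transRefl _⟩

end TwoComplex

/-! ### The 2-cells -/

/-- The closed unit disk. -/
abbrev UnitDisk : Type := Metric.closedBall (0 : ℂ) 1

namespace UnitDisk

instance : SimplyConnectedSpace UnitDisk :=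
  (convex_closedBall (0 : ℂ) 1).simplyConnectedSpace ⟨0, by simp⟩

/-- The boundary circle of the unit disk. -/
def ofCircle : C(Circle, UnitDisk) where
  toFun w := ⟨w, by simp [Circle.norm_coe]⟩
  continuous_toFun := by fun_prop

@[simp] theorem coe_ofCircle (w : Circle) : (ofCircle w : ℂ) = w := rfl

/-- The parametrization of the circle by the unit interval. -/
noncomputable def circleParam : C(I, Circle) where
  toFun t := Circle.exp (2 * Real.pi * t)
  continuous_toFun := by fun_prop

theorem coe_circleParam (t : I) :
    (circleParam t : ℂ) = Complex.exp (2 * Real.pi * (t : ℝ) * Complex.I) := by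
  simp [circleParam, Circle.coe_exp]

theorem circleParam_surjective : Function.Surjective circleParam := by
  intro w
  have hpi := Real.pi_pos
  obtain ⟨x, hx⟩ : ∃ x : ℝ, Circle.exp x = w := ⟨_, Circle.exp_arg w⟩
  refine ⟨⟨Int.fract (x / (2 * Real.pi)), Int.fract_nonneg _, (Int.fract_lt_one _).le⟩, ?_⟩
  rw [← hx]
  change Circle.exp (2 * Real.pi * Int.fract (x / (2 * Real.pi))) = _
  rw [Circle.exp_eq_exp]
  refine ⟨-⌊x / (2 * Real.pi)⌋, ?_⟩
  rw [Int.fract]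
  push_cast
  field_simp
  ring

/-- A continuous surjection from a compact space to a Hausdorff space is closed. -/
theorem isQuotientMap_circleParam : Topology.IsQuotientMap circleParam :=
  (circleParam.continuous.isClosedMap).isQuotientMap circleParam.continuous circleParam_surjective

theorem apply_eq_of_circleParam_eq {Z : Type*} {g : I → Z} (hg : g 0 = g 1) {s t : I}
    (h : circleParam s = circleParam t) : g s = g t := by
  have hpi := Real.pi_pos
  obtain ⟨m, hm⟩ := Circle.exp_eq_exp.mp h
  have h1 : (s : ℝ) = t + m := by
    have : 2 * Real.pi * (s : ℝ) = 2 * Real.pi * (t + m) := by rw [hm]; ring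
    exact mul_left_cancel₀ (by positivity) this
  have hs := s.2
  have ht := t.2
  simp only [Set.mem_Icc] at hs ht
  have hm1 : (-1 : ℝ) ≤ m := by linarith
  have hm2 : (m : ℝ) ≤ 1 := by linarith
  have hm1' : -1 ≤ m := by exact_mod_cast hm1
  have hm2' : m ≤ 1 := by exact_mod_cast hm2
  obtain rfl | rfl | rfl : m = -1 ∨ m = 0 ∨ m = 1 := by omega
  · push_cast at h1
    obtain rfl : s = 0 := Subtype.ext (show (s : ℝ) = 0 by linarith)
    obtain rfl : t = 1 := Subtype.ext (show (t : ℝ) = 1 by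
      simp only [Set.Icc.coe_zero] at h1; linarith)
    exact hg
  · obtain rfl : s = t := Subtype.ext (by simpa using h1)
    rfl
  · push_cast at h1
    obtain rfl : t = 0 := Subtype.ext (show (t : ℝ) = 0 by linarith)
    obtain rfl : s = 1 := Subtype.ext (show (s : ℝ) = 1 by
      simp only [Set.Icc.coe_zero] at h1; linarith)
    exact hg.symm

/-- A complex number of norm `1` as a point of the circle. -/
def circleMk (z : ℂ) (h : ‖z‖ = 1) : Circle := ⟨z, mem_sphere_zero_iff_norm.mpr h⟩

@[simp] theorem coe_circleMk (z : ℂ) (h : ‖z‖ = 1) : (circleMk z h : ℂ) = z := rfl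

open Classical in
/-- The radial projection to the circle; the center goes to `1`. -/
noncomputable def dir (z : UnitDisk) : Circle :=
  if h : (z : ℂ) = 0 then 1 else circleMk (z / ‖(z : ℂ)‖) (by
    rw [norm_div, Complex.norm_real, norm_norm, div_self (norm_ne_zero_iff.mpr h)])

theorem coe_dir {z : UnitDisk} (h : (z : ℂ) ≠ 0) : (dir z : ℂ) = z / ‖(z : ℂ)‖ := by
  rw [dir, dif_neg h, coe_circleMk]

@[simp] theorem dir_ofCircle (w : Circle) : dir (ofCircle w) = w := by
  ext
  rw [coe_dir (by simp)]
  simp [Circle.norm_coe]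

theorem isInducing_circle_coe : Topology.IsInducing (fun w : Circle => (w : ℂ)) := ⟨rfl⟩

theorem continuousOn_dir : ContinuousOn dir {z : UnitDisk | (z : ℂ) ≠ 0} := by
  rw [isInducing_circle_coe.continuousOn_iff]
  have : ContinuousOn (fun z : UnitDisk => (z : ℂ) / ‖(z : ℂ)‖) {z : UnitDisk | (z : ℂ) ≠ 0} := by
    refine ContinuousOn.div (by fun_prop) (by fun_prop) fun z hz => ?_
    simpa using hz
  exact this.congr fun z hz => coe_dir hz

/-- The radial segment from the circle to `z`. -/
noncomputable def radial (z : UnitDisk) : Path (ofCircle (dir z)) z where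
  toFun t := ⟨(1 - t : ℝ) • (dir z : ℂ) + (t : ℝ) • (z : ℂ),
    convex_closedBall (0 : ℂ) 1 (ofCircle (dir z)).2 z.2 (by linarith [t.2.2]) t.2.1 (by ring)⟩
  continuous_toFun := by fun_prop
  source' := by ext; simp
  target' := by ext; simp

theorem radial_ofCircle (w : Circle) (t : I) : radial (ofCircle w) t = ofCircle w := by
  ext
  change (1 - t : ℝ) • (dir (ofCircle w) : ℂ) + (t : ℝ) • (w : ℂ) = w
  rw [dir_ofCircle, ← add_smul]
  simp

theorem continuousOn_radial :
    ContinuousOn (fun z => (radial z).toContinuousMap) {z : UnitDisk | (z : ℂ) ≠ 0} := by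
  refine ContinuousMap.continuousOn_of_continuousOn_uncurry _ ?_
  rw [Topology.IsInducing.subtypeVal.continuousOn_iff]
  have h1 : ContinuousOn (fun p : UnitDisk × I => (dir p.1 : ℂ)) ({z : UnitDisk | (z : ℂ) ≠ 0} ×ˢ Set.univ) :=
    continuous_subtype_val.comp_continuousOn
      (continuousOn_dir.comp continuous_fst.continuousOn fun p hp => hp.1)
  have h2 : ContinuousOn (fun p : UnitDisk × I => (1 - (p.2 : ℝ)) • (dir p.1 : ℂ) +
      (p.2 : ℝ) • (p.1 : ℂ)) ({z : UnitDisk | (z : ℂ) ≠ 0} ×ˢ Set.univ) := by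
    
    refine ContinuousOn.add (ContinuousOn.smul (f := fun p : UnitDisk × I => 1 - (p.2 : ℝ)) ?_ h1) ?_
    · exact Continuous.continuousOn (by fun_prop)
    · exact Continuous.continuousOn (by fun_prop)
  exact h2

end UnitDisk

open UnitDisk

namespace TwoComplex

variable {E : Type u} {F : Type v} (X : TwoComplex.{u, v, w} E F)

/-- The attaching map of a 2-cell on the circle. -/
noncomputable def attach (f : F) : C(Circle, X.Skeleton) :=
  isQuotientMap_circleParam.lift (X.skelPath (X.bdry f)).toContinuousMap fun _ _ h =>
    apply_eq_of_circleParam_eq (by simp) h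

@[simp] theorem attach_circleParam (f : F) (t : I) :
    X.attach f (circleParam t) = X.skelPath (X.bdry f) t :=
  congr_fun (congr_arg DFunLike.coe (isQuotientMap_circleParam.lift_comp
    (X.skelPath (X.bdry f)).toContinuousMap fun _ _ h =>
      apply_eq_of_circleParam_eq (by simp) h)) t

/-- The characteristic map of a 2-cell. -/
def cell (f : F) : C(UnitDisk, X.Space) where
  toFun z := Quot.mk _ (.inr ⟨f, z⟩)
  continuous_toFun := continuous_quot_mk.comp (continuous_inr.comp continuous_sigmaMk)

theorem cell_ofCircle (f : F) (w : Circle) :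
    X.cell f (ofCircle w) = X.ofSkeleton (X.attach f w) := by
  obtain ⟨t, rfl⟩ := circleParam_surjective w
  rw [attach_circleParam]
  exact Quot.sound (.bdry f t _ (coe_circleParam t))

/-- Functions on the complex. -/
def spaceLift {Z : Type*} (a : X.Skeleton → Z) (b : F → UnitDisk → Z)
    (h : ∀ f w, b f (ofCircle w) = a (X.attach f w)) : X.Space → Z :=
  Quot.lift (Sum.elim a fun x => b x.1 x.2) fun _ _ hg => by
    cases hg with
    | bdry f t z hz =>
      obtain rfl : z = ofCircle (circleParam t) := by
        ext
        rw [hz, coe_ofCircle, coe_circleParam]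
      exact (h f _).trans (by rw [attach_circleParam]; rfl)

theorem space_ind {P : X.Space → Prop} (hs : ∀ s, P (X.ofSkeleton s))
    (hc : ∀ f (z : UnitDisk), ‖(z : ℂ)‖ < 1 → P (X.cell f z)) (x : X.Space) : P x := by
  induction x using Quot.ind with | _ x =>
  rcases x with s | ⟨f, z⟩
  · exact hs s
  · change P (X.cell f z)
    rcases (mem_closedBall_zero_iff.mp z.2).lt_or_eq with h | h
    · exact hc f z h
    · have hz : z = ofCircle (circleMk z h) := rfl
      rw [hz, cell_ofCircle]
      exact hs _

theorem isOpen_space_iff {S : Set X.Space} :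
    IsOpen S ↔ IsOpen (X.ofSkeleton ⁻¹' S) ∧ ∀ f, IsOpen (X.cell f ⁻¹' S) := by
  refine ⟨fun h => ⟨h.preimage X.ofSkeleton.continuous, fun f => h.preimage (X.cell f).continuous⟩,
    fun h => ?_⟩
  exact (isQuotientMap_quot_mk (r := X.FaceGlue)).isOpen_preimage.mp
    (isOpen_sum_iff.mpr ⟨h.1, isOpen_sigma_iff.mpr h.2⟩)

theorem continuousOn_space {Z : Type*} [TopologicalSpace Z] {g : X.Space → Z}
    {S : Set X.Space} (hS : IsOpen S) (hs : ContinuousOn (g ∘ X.ofSkeleton) (X.ofSkeleton ⁻¹' S))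
    (hc : ∀ f, ContinuousOn (g ∘ X.cell f) (X.cell f ⁻¹' S)) : ContinuousOn g S := by
  rw [continuousOn_open_iff hS]
  intro T hT
  rw [isOpen_space_iff]
  exact ⟨(continuousOn_open_iff (hS.preimage X.ofSkeleton.continuous)).mp hs T hT, fun f =>
    (continuousOn_open_iff (hS.preimage (X.cell f).continuous)).mp (hc f) T hT⟩

/-- The complement of the centers of the 2-cells. -/
def punctured : Set X.Space :=
  {x | X.spaceLift (fun _ => True) (fun _ z => (z : ℂ) ≠ 0) (by simp) x}

/-- The interior of a 2-cell. -/
def openCell (f : F) : Set X.Space :=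
  {x | X.spaceLift (fun _ => False) (fun g z => g = f ∧ ‖(z : ℂ)‖ < 1)
    (by simp [Circle.norm_coe]) x}

theorem isOpen_punctured : IsOpen X.punctured :=
  X.isOpen_space_iff.mpr ⟨isOpen_univ, fun _ => isOpen_ne_fun continuous_subtype_val continuous_const⟩

theorem isOpen_openCell (f : F) : IsOpen (X.openCell f) :=
  X.isOpen_space_iff.mpr ⟨isOpen_empty, fun g =>
    (isOpen_const (p := g = f)).inter (isOpen_lt (f := fun z : UnitDisk => ‖(z : ℂ)‖)
      (by fun_prop) (continuous_const (y := (1 : ℝ))))⟩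

theorem mem_punctured_or_exists_mem_openCell (x : X.Space) :
    x ∈ X.punctured ∨ ∃ f, x ∈ X.openCell f := by
  induction x using X.space_ind with
  | hs s => exact .inl trivial
  | hc f z h => exact .inr ⟨f, rfl, h⟩

/-- The path system of radial paths from the 1-skeleton. -/
noncomputable def radialSystem : PathSystem X.ofSkeleton where
  start := X.spaceLift id (fun f z => X.attach f (dir z)) (by simp)
  path := X.spaceLift (fun s => .const I (X.ofSkeleton s))
    (fun f z => (X.cell f).comp (radial z).toContinuousMap) fun f w => by
      ext t
      simp [radial_ofCircle, cell_ofCircle]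
  path_zero x := by
    induction x using X.space_ind with
    | hs s => rfl
    | hc f z h =>
      change X.cell f (radial z 0) = X.ofSkeleton (X.attach f (dir z))
      rw [(radial z).source, cell_ofCircle]
  path_one x := by
    induction x using X.space_ind with
    | hs s => rfl
    | hc f z h =>
      change X.cell f (radial z 1) = _
      rw [(radial z).target]

theorem continuousOn_radialSystem : ContinuousOn X.radialSystem.path X.punctured := by
  refine X.continuousOn_space X.isOpen_punctured ?_ fun f => ?_
  · exact (ContinuousMap.continuous_of_continuous_uncurry
      (fun s => ContinuousMap.const I (X.ofSkeleton s))
      (X.ofSkeleton.continuous.comp continuous_fst)).continuousOn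
  · exact (ContinuousMap.continuous_postcomp (X.cell f)).comp_continuousOn continuousOn_radial

theorem continuousOn_radialSystem_start : ContinuousOn X.radialSystem.start X.punctured := by
  refine X.continuousOn_space X.isOpen_punctured ?_ fun f => ?_
  · exact continuousOn_id
  · exact (X.attach f).continuous.comp_continuousOn continuousOn_dir

/-! #### Extension of a flat atlas from the 1-skeleton -/

section Atlas

variable {ι H : Type*} [Group H] [TopologicalSpace H] [DiscreteTopology H]
  (𝒜 : FlatAtlas ι X.Skeleton H)

/-- Trivial holonomy means that the flat section along the boundary path has equal end values, so it
descends to the circle. -/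
theorem exists_isFlat_attach {f : F} (hf : 𝒜.hol (X.skelPath (X.bdry f)) = 1) :
    ∃ s : Circle → H, 𝒜.IsFlat (X.attach f) s := by
  let l := 𝒜.lift (X.skelPath (X.bdry f)).toContinuousMap
  have hl : l 0 = l 1 := (𝒜.lift_zero _).trans hf.symm
  let s : Circle → H := l ∘ Function.surjInv circleParam_surjective
  have hs : s ∘ circleParam = l := funext fun t =>
    apply_eq_of_circleParam_eq hl (Function.surjInv_eq circleParam_surjective _)
  refine ⟨s, fun i => ?_⟩
  rw [isQuotientMap_circleParam.continuousOn_isOpen_iff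
    ((𝒜.isOpen_U i).preimage (X.attach f).continuous)]
  have := 𝒜.isFlat_lift (X.skelPath (X.bdry f)).toContinuousMap i
  convert this using 1
  · funext t
    change s (circleParam t) * 𝒜.sec i (X.attach f (circleParam t)) = _
    rw [attach_circleParam]
    exact congr_arg (· * _) (congr_fun hs t)
  · ext t
    simp

variable (h : ∀ f, 𝒜.hol (X.skelPath (X.bdry f)) = 1)

open Classical in
/-- The comparison function on the interiors of the 2-cells. -/
noncomputable def cellSec : X.Space → H :=
  X.spaceLift (fun _ => 1)
    (fun f z => if ‖(z : ℂ)‖ < 1 then ((X.exists_isFlat_attach 𝒜 (h f)).choose (dir z))⁻¹ else 1)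
    (by simp [Circle.norm_coe])

/-- On an open cell, `cellSec` is the inverse of the flat section along the attaching circle, pulled
back by `dir`. The expression is thus the one whose continuity defines flatness, composed with
`dir`. -/
theorem continuousOn_cellSec (i : ι) :
    ContinuousOn (fun x => (X.cellSec 𝒜 h x)⁻¹ * 𝒜.sec i (X.radialSystem.start x))
      ((⋃ f, X.openCell f) ∩ (X.punctured ∩ X.radialSystem.start ⁻¹' 𝒜.U i)) := by
  refine X.continuousOn_space ((isOpen_iUnion X.isOpen_openCell).inter
    (X.continuousOn_radialSystem_start.isOpen_inter_preimage X.isOpen_punctured (𝒜.isOpen_U i)))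
    ?_ fun f => ?_
  · refine continuousOn_empty _ |>.mono ?_
    rintro s ⟨hs, -⟩
    obtain ⟨f, hf⟩ := Set.mem_iUnion.mp hs
    exact hf
  · have h1 := (X.exists_isFlat_attach 𝒜 (h f)).choose_spec i
    refine (h1.comp (continuousOn_dir.mono ?_) ?_).congr ?_ (s := _) (f := _ ∘ dir)
    · rintro z ⟨-, hz, -⟩
      exact hz
    · rintro z ⟨-, -, hz⟩
      exact hz
    · rintro z ⟨hz, -⟩
      obtain ⟨g, hg⟩ := Set.mem_iUnion.mp hz
      have hz1 : ‖(z : ℂ)‖ < 1 := hg.2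
      change (ite _ _ _ : H)⁻¹ * _ = _
      rw [if_pos hz1, inv_inv]
      rfl

/-- The extension to the complex of a flat atlas on the 1-skeleton that has trivial holonomy along
the boundaries of the 2-cells. -/
noncomputable def extendAtlas : FlatAtlas (Option ι) X.Space H where
  U o := o.elim (⋃ f, X.openCell f) fun i => X.punctured ∩ X.radialSystem.start ⁻¹' 𝒜.U i
  isOpen_U o := by
    cases o
    · exact isOpen_iUnion X.isOpen_openCell
    · exact X.continuousOn_radialSystem_start.isOpen_inter_preimage X.isOpen_punctured
        (𝒜.isOpen_U _)
  cover x := by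
    rcases X.mem_punctured_or_exists_mem_openCell x with hx | hx
    · obtain ⟨i, hi⟩ := 𝒜.cover (X.radialSystem.start x)
      exact ⟨some i, hx, hi⟩
    · exact ⟨none, Set.mem_iUnion.mpr hx⟩
  sec o := o.elim (X.cellSec 𝒜 h) fun i x => 𝒜.sec i (X.radialSystem.start x)
  compat o o' := by
    rcases o with _ | i <;> rcases o' with _ | j
    · simpa using continuousOn_const
    · exact X.continuousOn_cellSec 𝒜 h j
    · have := (continuous_of_discreteTopology (f := fun x : H => x⁻¹)).comp_continuousOn
        (X.continuousOn_cellSec 𝒜 h i)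
      rw [Set.inter_comm] at this
      refine this.congr fun x _ => ?_
      simp
    · exact (𝒜.compat i j).comp (X.continuousOn_radialSystem_start.mono fun x hx => hx.1.1)
        fun x hx => ⟨hx.1.2, hx.2.2⟩

/-- On the 1-skeleton the radial retraction is the identity and the open cells are absent, so a flat
section for the old atlas is flat for the new one. -/
theorem hol_extendAtlas {x y : X.Skeleton} (γ : Path x y) :
    (X.extendAtlas 𝒜 h).hol (γ.map X.ofSkeleton.continuous) = 𝒜.hol γ := by
  have hf : (X.extendAtlas 𝒜 h).IsFlat (γ.map X.ofSkeleton.continuous)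
      (𝒜.lift γ.toContinuousMap) := by
    rintro (_ | i)
    · refine continuousOn_empty _ |>.mono ?_
      intro t ht
      obtain ⟨f, hf⟩ := Set.mem_iUnion.mp ht
      exact hf
    · exact (𝒜.isFlat_lift γ.toContinuousMap i).mono fun t ht => ht.2
  rw [hf.hol_eq, FlatAtlas.lift_zero, inv_one, one_mul]
  rfl

end Atlas

/-! #### Paths in the complex are homotopic to paths in the 1-skeleton -/

open Classical in
/-- The coordinate on the interiors of the 2-cells. -/
noncomputable def coord : X.Space → UnitDisk :=
  X.spaceLift (fun _ => ⟨0, by simp⟩) (fun _ z => if ‖(z : ℂ)‖ < 1 then z else ⟨0, by simp⟩)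
    (by simp [Circle.norm_coe])

theorem cell_coord {f : F} {x : X.Space} (hx : x ∈ X.openCell f) : X.cell f (X.coord x) = x := by
  induction x using X.space_ind with
  | hs s => exact hx.elim
  | hc g z h =>
    obtain rfl : g = f := hx.1
    congr 1
    exact if_pos h

theorem continuousOn_coord (f : F) : ContinuousOn X.coord (X.openCell f) := by
  refine X.continuousOn_space (X.isOpen_openCell f) ?_ fun g => ?_
  · exact continuousOn_const
  · refine continuousOn_id.congr fun z hz => ?_
    exact if_pos hz.2

/-- The boundary circle of the disk as a path. -/
noncomputable def circlePath : Path (ofCircle (circleParam 0)) (ofCircle (circleParam 1)) where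
  toFun t := ofCircle (circleParam t)
  source' := rfl
  target' := rfl

/-- Away from the centers a path is pushed out radially. Inside an open cell it may meet the center,
but everything factors through the simply connected disk, so an arc of the boundary path serves
instead. -/
theorem exists_path_radialSystem {x y : X.Space} (γ : Path x y) :
    ∃ η : Path (X.radialSystem.start x) (X.radialSystem.start y),
      ((X.radialSystem.to x).trans γ).Homotopic
        ((η.map X.ofSkeleton.continuous).trans (X.radialSystem.to y)) := by
  refine Path.induction_of_cover (U := fun o : Option F => o.elim X.punctured X.openCell)
    (P := fun {x y} γ => ∃ η : Path (X.radialSystem.start x) (X.radialSystem.start y),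
      ((X.radialSystem.to x).trans γ).Homotopic
        ((η.map X.ofSkeleton.continuous).trans (X.radialSystem.to y)))
    ?_ ?_ ?_ ?_ ?_ γ
  · rintro (_ | f)
    exacts [X.isOpen_punctured, X.isOpen_openCell f]
  · exact fun x => (X.mem_punctured_or_exists_mem_openCell x).elim (fun h => ⟨none, h⟩)
      fun ⟨f, h⟩ => ⟨some f, h⟩
  · rintro x y z γ δ ⟨p, hp⟩ ⟨q, hq⟩
    refine ⟨p.trans q, ?_⟩
    rw [← Path.Homotopic.Quotient.eq] at hp hq ⊢
    rw [Path.map_trans]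
    simp only [Path.Homotopic.Quotient.mk_trans] at hp hq ⊢
    rw [Path.Homotopic.Quotient.trans_assoc, ← hq, ← Path.Homotopic.Quotient.trans_assoc, hp,
      Path.Homotopic.Quotient.trans_assoc]
  · rintro x y γ δ h ⟨p, hp⟩
    exact ⟨p, ((Path.Homotopic.refl _).hcomp h.symm).trans hp⟩
  · rintro (_ | f) x y γ hγ
    · let η : Path (X.radialSystem.start x) (X.radialSystem.start y) :=
        { toFun := fun t => X.radialSystem.start (γ t)
          continuous_toFun := X.continuousOn_radialSystem_start.comp_continuous γ.continuous hγ
          source' := by rw [γ.source]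
          target' := by rw [γ.target] }
      exact ⟨η, X.radialSystem.homotopic X.continuousOn_radialSystem γ hγ fun t => rfl⟩
    · have hx : X.cell f (X.coord x) = x := X.cell_coord (by simpa using hγ 0)
      have hy : X.cell f (X.coord y) = y := X.cell_coord (by simpa using hγ 1)
      let δ : Path (X.coord x) (X.coord y) :=
        { toFun := fun t => X.coord (γ t)
          continuous_toFun := (X.continuousOn_coord f).comp_continuous γ.continuous hγ
          source' := by rw [γ.source]
          target' := by rw [γ.target] }
      -- Any parameters of the two directions will do: different arcs are homotopic in the disk.
      obtain ⟨a, ha⟩ := circleParam_surjective (dir (X.coord x))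
      obtain ⟨b, hb⟩ := circleParam_surjective (dir (X.coord y))
      have hrx : X.radialSystem.start x = X.skelPath (X.bdry f) a := by
        rw [← attach_circleParam, ha, ← congr_arg X.radialSystem.start hx]
        rfl
      have hry : X.radialSystem.start y = X.skelPath (X.bdry f) b := by
        rw [← attach_circleParam, hb, ← congr_arg X.radialSystem.start hy]
        rfl
      refine ⟨((X.skelPath (X.bdry f)).subpath a b).cast hrx hry, ?_⟩
      refine Path.homotopic_of_factor (X.cell f) ((radial (X.coord x)).trans δ)
        (((circlePath.subpath a b).cast (congr_arg ofCircle ha.symm)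
          (congr_arg ofCircle hb.symm)).trans (radial (X.coord y))) ?_ ?_
      · refine Path.trans_factor (fun t => ?_) fun t => (X.cell_coord (hγ t)).symm
        change X.radialSystem.path x t = _
        rw [← congr_arg X.radialSystem.path hx]
        rfl
      · refine Path.trans_factor (fun t => ?_) fun t => ?_
        · change X.ofSkeleton (X.skelPath (X.bdry f) _) = X.cell f (ofCircle (circleParam _))
          rw [cell_ofCircle, attach_circleParam]
        · change X.radialSystem.path y t = _
          rw [← congr_arg X.radialSystem.path hy]
          rfl

/-- A path in the complex between vertices is homotopic to an edge path. -/
theorem exists_edgePath_homotopic {v w : X.V} (γ : Path (X.vert v) (X.vert w)) :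
    ∃ p : EdgePath X.src X.tgt v w,
      γ.Homotopic ((X.skelPath p).map X.ofSkeleton.continuous) := by
  obtain ⟨η, hη⟩ := X.exists_path_radialSystem γ
  obtain ⟨p, hp⟩ := X.exists_skelPath_homotopic (v := v) (w := w) η
  refine ⟨p, Path.Homotopic.trans ?_ (hp.map X.ofSkeleton)⟩
  have h1 : ((Path.refl _).trans γ).Homotopic
    ((η.map X.ofSkeleton.continuous).trans (Path.refl _)) := hη
  exact (Path.Homotopic.trans ⟨(Path.Homotopy.reflTrans γ).symm⟩ h1).trans
    ⟨Path.Homotopy.transRefl _⟩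

/-- The boundary of a 2-cell is null-homotopic. -/
theorem bdry_homotopic_refl (f : F) :
    ((X.skelPath (X.bdry f)).map X.ofSkeleton.continuous).Homotopic (Path.refl _) := by
  have h01 : circleParam 1 = circleParam 0 := by
    ext
    simp [coe_circleParam]
  -- The boundary loop is the image of the circle in the disk, where it contracts.
  refine Path.homotopic_of_factor (X.cell f) (circlePath.cast rfl (congr_arg ofCircle h01.symm))
    (Path.refl _) (fun t => ?_) fun t => ?_
  · change _ = X.cell f (ofCircle (circleParam t))
    rw [cell_ofCircle, attach_circleParam]
    rfl
  · change _ = X.cell f (ofCircle (circleParam 0))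
    rw [cell_ofCircle, attach_circleParam, Path.source]
    rfl

/-! #### Homomorphisms from the fundamental group -/

theorem monoidHom_ext {H : Type*} [Group H] {v : X.V} {φ ψ : X.Pi1 v →* H}
    (h : ∀ p : EdgePath X.src X.tgt v v, φ (X.loopClass p) = ψ (X.loopClass p)) : φ = ψ := by
  ext α
  obtain ⟨α⟩ := α
  induction α using Quotient.ind with | _ γ =>
  obtain ⟨p, hp⟩ := X.exists_edgePath_homotopic γ
  have : (MulOpposite.op (FundamentalGroup.fromPath (Path.Homotopic.Quotient.mk γ)) : X.Pi1 v) =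
      X.loopClass p := by
    rw [loopClass, Path.Homotopic.Quotient.eq.mpr hp]
  exact (congr_arg φ this).trans ((h p).trans (congr_arg ψ this.symm))

/-- A labelling of the edges by a group whose products along the boundaries of the 2-cells are
trivial induces a path functional on the complex. -/
theorem exists_pathFunctional {H : Type*} [Group H] (h : E → H) (hF : ∀ f, (X.bdry f).eval h = 1) :
    ∃ T : PathFunctional X.Space H, ∀ {w w' : X.V} (p : EdgePath X.src X.tgt w w'),
      T.toFun ((X.skelPath p).map X.ofSkeleton.continuous) = p.eval h := by
  let _ : TopologicalSpace H := ⊥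
  have : DiscreteTopology H := ⟨rfl⟩
  have h1 {w w' : X.V} (p : EdgePath X.src X.tgt w w') :
      (X.skelAtlas h).hol (X.skelPath p) = p.eval h := by
    refine (X.map_skelPath (X.skelAtlas h).functional p).trans ?_
    congr 1
    funext e
    exact X.hol_edge h e
  let 𝒜 := X.extendAtlas (X.skelAtlas h) fun f => (h1 _).trans (hF f)
  refine ⟨𝒜.functional, fun p => ?_⟩
  exact (X.hol_extendAtlas _ _ _).trans (h1 p)

end TwoComplex

/-! ### Products along edge paths -/

namespace EdgePath

variable {V E G : Type*} {src tgt : E → V} [Group G]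

theorem map_eval {G' : Type*} [Group G'] (f : G →* G') (g : E → G) {v w : V}
    (p : EdgePath src tgt v w) : f (p.eval g) = p.eval fun e => f (g e) := by
  simp [eval, map_list_prod, Function.comp_def]

/-- Gauge factors at intermediate vertices cancel in pairs. -/
theorem eval_conj (g : E → G) (c : V → G) {v w : V} (p : EdgePath src tgt v w) :
    p.eval (fun e => (c (src e))⁻¹ * g e * c (tgt e)) = (c v)⁻¹ * p.eval g * c w := by
  induction p with
  | nil v => simp [eval_nil]
  | fwd e p ih => rw [eval_fwd, eval_fwd, ih]; group
  | bwd e p ih => rw [eval_bwd, eval_bwd, ih]; group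

theorem eval_mul_zpow (g : E → G) {J : G} (hJ : ∀ x, J * x = x * J) (m : E → ℤ) {v w : V}
    (p : EdgePath src tgt v w) :
    p.eval (fun e => g e * J ^ m e) =
      p.eval g * J ^ (p.word.map fun x => (x.2 : ℤ) * m x.1).sum := by
  have hc (n : ℤ) (x : G) : J ^ n * x = x * J ^ n := (Commute.zpow_left (hJ x) n)
  induction p with
  | nil v => simp [eval_nil, word]
  | fwd e p ih =>
    rw [eval_fwd, eval_fwd, ih]
    simp only [word, List.map_cons, List.sum_cons, Units.val_one, one_mul, zpow_add]
    rw [mul_assoc, mul_assoc, ← mul_assoc (J ^ m e), hc, mul_assoc, hc]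
  | bwd e p ih =>
    rw [eval_bwd, eval_bwd, ih]
    simp only [word, List.map_cons, List.sum_cons, Units.val_neg, Units.val_one, neg_mul, one_mul,
      zpow_add, mul_inv_rev, ← zpow_neg]
    rw [hc, mul_assoc, mul_assoc, ← mul_assoc (J ^ (-m e)), hc]
    simp [mul_assoc]

end EdgePath

/-! ### The solution group -/

namespace SignedArrangement

variable {L : Type u} (A : SignedArrangement L) {d : ℕ} (τ : A.contexts → ZMod d)

theorem solJ_pow : A.solJ τ ^ d = 1 := by
  have h : (PresentedGroup.mk {r | A.SolutionRel τ r}) (freeJ L ^ d) = 1 :=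
    PresentedGroup.one_of_mem SolutionRel.J_pow
  rwa [map_pow] at h

theorem solProj_solJ : A.solProj τ (A.solJ τ) = 1 :=
  (QuotientGroup.eq_one_iff _).mpr (Subgroup.mem_zpowers _)

theorem prod_solG (C : A.contexts) {l : List L} (hl : (l : Multiset L) = C.1.val) :
    (l.map fun a => A.solG τ a ^ (A.sign C a : ℤ)).prod = A.solJ τ ^ (τ C).val := by
  have h : (PresentedGroup.mk {r | A.SolutionRel τ r}) _ = 1 :=
    PresentedGroup.one_of_mem (SolutionRel.context C l hl)
  rw [map_mul, map_inv, mul_inv_eq_one, map_list_prod, map_pow, List.map_map] at h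
  simp only [Function.comp_def, map_zpow] at h
  exact h

theorem solJ_zpow_eq_one {n : ℤ} (hn : (n : ZMod d) = 0) : A.solJ τ ^ n = 1 := by
  obtain ⟨k, rfl⟩ := (ZMod.intCast_zmod_eq_zero_iff_dvd n d).mp hn
  rw [zpow_mul, zpow_natCast, A.solJ_pow, one_zpow]

/-- Since `ω` is a primitive `d`-th root of unity, equality of its powers is congruence of exponents
modulo `d`. -/
theorem isClassicalRealization_iff [NeZero d] (c : L → ZMod d) :
    A.IsClassicalRealization τ c ↔
      ∀ C : A.contexts, ∑ a ∈ C.1, ((A.sign C a : ℤ) : ZMod d) * c a = τ C := by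
  refine forall_congr' fun C => ?_
  have hω := Complex.isPrimitiveRoot_exp d (NeZero.ne d)
  set ω := Complex.exp (2 * Real.pi * Complex.I / d)
  have h0 : ω ≠ 0 := Complex.exp_ne_zero _
  have hprod : ∏ a ∈ C.1, ω ^ ((A.sign C a : ℤ) * ((c a).val : ℤ)) =
      ω ^ (∑ a ∈ C.1, (A.sign C a : ℤ) * ((c a).val : ℤ)) := by
    induction C.1 using Finset.cons_induction with
    | empty => simp
    | cons a s ha ih => rw [Finset.prod_cons, Finset.sum_cons, ih, zpow_add₀ h0]
  rw [hprod, ← zpow_natCast, ← div_eq_one_iff_eq (zpow_ne_zero _ h0), ← zpow_sub₀ h0,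
    hω.zpow_eq_one_iff_dvd, ← ZMod.intCast_zmod_eq_zero_iff_dvd]
  push_cast
  simp [sub_eq_zero]

end SignedArrangement

/-! ### Topological realizations -/

namespace TwoComplex.IsTopologicalRealization

variable {L : Type u} {A : SignedArrangement L} {d : ℕ} (τ : A.contexts → ZMod d)
  {X : TwoComplex.{u, u, w} L A.contexts} (hX : X.IsTopologicalRealization A)

include hX

/-- The boundary word enumerates the context in some order, and the context relators cover every
order. -/
theorem eval_bdry (C : A.contexts) :
    (X.bdry C).eval (A.solG τ) = A.solJ τ ^ (τ C).val := by
  have h := hX.bdry_word C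
  have hl : (((X.bdry C).word.map Prod.fst : List L) : Multiset L) = C.1.val := by
    rw [← Multiset.map_coe, h, Multiset.map_map]
    simp
  rw [← A.prod_solG τ C hl, List.map_map, EdgePath.eval]
  congr 1
  refine List.map_congr_left fun x hx => ?_
  have : x ∈ C.1.val.map fun a => (a, A.sign C a) := by
    rw [← h]
    exact hx
  obtain ⟨a, -, rfl⟩ := Multiset.mem_map.mp this
  rfl

theorem sum_bdry (C : A.contexts) (m : L → ℤ) :
    ((X.bdry C).word.map fun x => (x.2 : ℤ) * m x.1).sum = ∑ a ∈ C.1, (A.sign C a : ℤ) * m a := by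
  rw [← Multiset.sum_coe, ← Multiset.map_coe, hX.bdry_word C, Multiset.map_map]
  rfl

theorem eval_bdry_mul_zpow (C : A.contexts) (m : L → ℤ) :
    (X.bdry C).eval (fun a => A.solG τ a * A.solJ τ ^ m a) =
      A.solJ τ ^ (((τ C).val : ℤ) + ∑ a ∈ C.1, (A.sign C a : ℤ) * m a) := by
  rw [EdgePath.eval_mul_zpow _ (A.solJ_commute τ), hX.eval_bdry, hX.sum_bdry, zpow_add,
    zpow_natCast]

theorem exists_functional :
    ∃ T : PathFunctional X.Space (A.SolutionQuotient τ),
      ∀ {w w' : X.V} (p : EdgePath X.src X.tgt w w'),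
        T.toFun ((X.skelPath p).map X.ofSkeleton.continuous) =
          A.solProj τ (p.eval (A.solG τ)) := by
  obtain ⟨T, hT⟩ := X.exists_pathFunctional (fun a => A.solProj τ (A.solG τ a)) fun C => by
    rw [← EdgePath.map_eval, hX.eval_bdry, map_pow, A.solProj_solJ, one_pow]
  exact ⟨T, fun p => by rw [hT, EdgePath.map_eval]⟩

theorem exists_lift [NeZero d] {c : L → ZMod d} (hc : A.IsClassicalRealization τ c) (v : X.V) :
    ∃ θ : X.Pi1 v →* A.SolutionGroup τ, ∀ p : EdgePath X.src X.tgt v v,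
      A.solProj τ (θ (X.loopClass p)) = A.solProj τ (p.eval (A.solG τ)) := by
  rw [A.isClassicalRealization_iff] at hc
  obtain ⟨T, hT⟩ := X.exists_pathFunctional
    -- The twist by `-c` cancels `J ^ τ C` around each 2-cell and is invisible modulo `J`.
    (fun a => A.solG τ a * A.solJ τ ^ (-((c a).val : ℤ))) fun C => by
      rw [hX.eval_bdry_mul_zpow]
      refine A.solJ_zpow_eq_one τ ?_
      push_cast
      simp [← hc C]
  refine ⟨T.toMonoidHom (X.vert v), fun p => ?_⟩
  refine (congr_arg (A.solProj τ) (hT p)).trans ?_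
  rw [EdgePath.map_eval, EdgePath.map_eval]
  simp only [map_mul, map_zpow, A.solProj_solJ, one_zpow, mul_one]

/-- The lift yields edge labels in `G` that are trivial around every 2-cell and differ from the
generators by powers of `J`; the exponents solve the constraints up to sign. -/
theorem exists_isClassicalRealization [NeZero d] (hJ : orderOf (A.solJ τ) = d) {v : X.V}
    (θ : X.Pi1 v →* A.SolutionGroup τ)
    (hθ : ∀ p : EdgePath X.src X.tgt v v,
      A.solProj τ (θ (X.loopClass p)) = A.solProj τ (p.eval (A.solG τ))) :
    ∃ c : L → ZMod d, A.IsClassicalRealization τ c := by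
  have := hX.connected
  have := X.pathConnectedSpace
  obtain ⟨T, hT⟩ := hX.exists_functional τ
  have hTθ : T.toMonoidHom (X.vert v) = (A.solProj τ).comp θ :=
    X.monoidHom_ext fun p => (hT p).trans (hθ p).symm
  let Q (x : X.Space) : Path (X.vert v) x := PathConnectedSpace.somePath _ _
  let S := PathFunctional.ofMonoidHom θ Q
  have hS {x y : X.Space} (γ : Path x y) :
      A.solProj τ (S.toFun γ) = T.toFun (Q x) * T.toFun γ * (T.toFun (Q y))⁻¹ := by
    rw [← T.map_symm, ← T.map_trans, ← T.map_trans]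
    exact (DFunLike.congr_fun hTθ _).symm
  -- Modulo `J`, the label `k e` is the class of `g e` distorted by the arbitrary paths `Q` to its
  -- endpoints. Lifts `q` of these distortions undo it, while products around 2-cells stay trivial.
  choose q hq using fun w : X.V => QuotientGroup.mk'_surjective _ (T.toFun (Q (X.vert w)))
  let k (e : L) := S.toFun ((X.edge e).map X.ofSkeleton.continuous)
  let h (e : L) := (q (X.src e))⁻¹ * k e * q (X.tgt e)
  have hk (C : A.contexts) : (X.bdry C).eval k = 1 := by
    refine (X.map_skelPath (S.comap X.ofSkeleton) (X.bdry C)).symm.trans ?_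
    exact (S.map_homotopic (X.bdry_homotopic_refl C)).trans (S.map_refl _)
  have hh (C : A.contexts) : (X.bdry C).eval h = 1 := by
    rw [EdgePath.eval_conj, hk]
    group
  have hproj (e : L) : A.solProj τ (A.solG τ e) = A.solProj τ (h e) := by
    have h1 : T.toFun ((X.edge e).map X.ofSkeleton.continuous) = A.solProj τ (A.solG τ e) := by
      refine (hT (.fwd e (.nil _))).trans ?_
      rw [EdgePath.eval_fwd, EdgePath.eval_nil, mul_one]
    have h2 : A.solProj τ (k e) = _ := hS ((X.edge e).map X.ofSkeleton.continuous)
    rw [map_mul, map_mul, map_inv, h2, ← h1]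
    change _ = (QuotientGroup.mk' _ (q _))⁻¹ * _ * QuotientGroup.mk' _ (q _)
    rw [hq, hq]
    simp only [vert]
    group
  choose m hm using fun e => Subgroup.mem_zpowers_iff.mp (QuotientGroup.eq.mp (hproj e))
  have hg : h = fun e => A.solG τ e * A.solJ τ ^ m e := by
    funext e
    rw [hm, mul_inv_cancel_left]
  -- The boundary relation reads `τ C + ∑ ε m = 0` modulo `d`, hence the sign.
  refine ⟨fun a => -(m a : ZMod d), (A.isClassicalRealization_iff τ _).mpr fun C => ?_⟩
  have h1 := hh C
  rw [hg, hX.eval_bdry_mul_zpow, ← orderOf_dvd_iff_zpow_eq_one, hJ,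
    ← ZMod.intCast_zmod_eq_zero_iff_dvd] at h1
  push_cast at h1
  simp only [ZMod.natCast_val, ZMod.cast_id', id_eq] at h1
  simp only [mul_neg, Finset.sum_neg_distrib]
  exact (eq_neg_of_add_eq_zero_left h1).symm

end TwoComplex.IsTopologicalRealization

/-! ### The homomorphism `θ` and its lifts -/

theorem mainTheorem4 {L : Type u} [Finite L] (A : SignedArrangement L)
    {d : ℕ} (hd : 2 ≤ d) (τ : A.contexts → ZMod d)
    (X : TwoComplex.{u, u, w} L A.contexts) (hX : X.IsTopologicalRealization A) (v : X.V) :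
    ∃ θ : X.Pi1 v →* A.SolutionQuotient τ,
      (∀ p : EdgePath X.src X.tgt v v,
        θ (X.loopClass p) = A.solProj τ (p.eval (A.solG τ))) ∧
      (∀ θ' : X.Pi1 v →* A.SolutionQuotient τ,
        (∀ p : EdgePath X.src X.tgt v v,
          θ' (X.loopClass p) = A.solProj τ (p.eval (A.solG τ))) → θ' = θ) ∧
      ((∃ c : L → ZMod d, A.IsClassicalRealization τ c) →
        ∃ θ₁ : X.Pi1 v →* A.SolutionGroup τ, (A.solProj τ).comp θ₁ = θ) ∧
      (orderOf (A.solJ τ) = d →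
        ((∃ c : L → ZMod d, A.IsClassicalRealization τ c) ↔
          ∃ θ₁ : X.Pi1 v →* A.SolutionGroup τ, (A.solProj τ).comp θ₁ = θ)) := by
  have : NeZero d := ⟨by omega⟩
  obtain ⟨T, hT⟩ := hX.exists_functional τ
  have hθ (p : EdgePath X.src X.tgt v v) : T.toMonoidHom (X.vert v) (X.loopClass p) =
      A.solProj τ (p.eval (A.solG τ)) := hT p
  have hlift : (∃ c : L → ZMod d, A.IsClassicalRealization τ c) →
      ∃ θ₁ : X.Pi1 v →* A.SolutionGroup τ,
        (A.solProj τ).comp θ₁ = T.toMonoidHom (X.vert v) := by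
    rintro ⟨c, hc⟩
    obtain ⟨θ₁, h₁⟩ := hX.exists_lift τ hc v
    exact ⟨θ₁, X.monoidHom_ext fun p => (h₁ p).trans (hθ p).symm⟩
  refine ⟨T.toMonoidHom (X.vert v), hθ, fun θ' hθ' => X.monoidHom_ext fun p => ?_, hlift,
    fun hJ => ⟨hlift, ?_⟩⟩
  · rw [hθ', hθ]
  · rintro ⟨θ₁, h₁⟩
    refine hX.exists_isClassicalRealization τ hJ θ₁ fun p => ?_
    rw [← hθ, ← h₁]
    rfl
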